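/- A pushdown automaton (PDA) over a finite nonempty alphabet $\Sigma$ is $P=(Q,\Sigma,\Gamma,\delta,q_0,\gamma_0)$ with $Q,\Gamma$ finite, $q_0\in Q$, $\gamma_0\in\Gamma$, and $\delta$ a finite subset of $Q\times(\Sigma\cup\{\varepsilon\})\times\Gamma\times Q\times\Gamma^*$. An element $(q,b,\gamma,p,\xi')\in\delta$ allows the moves $(q,bw,\gamma\xi)\vdash(p,w,\xi'\xi)$. A run on $w\in\Sigma^*$ is a sequence of moves from $(q_0,w,\gamma_0)$ to some $(q,\varepsilon,\varepsilon)$. Dyck words are the words of the language $L_D$ over $\{\bar a,a\}$ generated by $S\to\bar a\,S\,a\,S\mid\varepsilon$; two letters $\bar a$, $a$ form a matching pair if they come from the same application of a rule. Write $u\preceq w$ if the Dyck word $u$ results from the Dyck word $w$ by deleting zero or more matching pairs. Let $h_0=\varepsilon$ and $h_{i+1}=\bar a h_i a\,\bar a h_i a$. The rank of $w\in L_D$ is the greatest $q$ with $h_q\preceq w$. The footprint of a run is the Dyck word that consists of $\bar a$ followed, for each move of the run in order, by $a\,\bar a^{d}$, where $d=|\xi'|$ is the number of stack symbols which that move writes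 in place of the top symbol. The oscillation of a run is the rank of its footprint. For $k\ge 0$, a language $L\subseteq\Sigma^*$ is $k$-oscillating if there is a PDA $P$ over $\Sigma$ such that $L$ is the set of words that have a run of $P$ of oscillation exactly $k$; $L$ is a bounded-oscillation language if it is $k$-oscillating for some $k\ge0$. A deterministic context-free language (DCFL) is a language accepted by final state by a deterministic PDA. Then: 1. (Union.) For every $k\ge 0$, the union of two $k$-oscillating languages over the same alphabet is $k$-oscillating; the union of two bounded-oscillation languages over the same alphabet is a bounded-oscillation language. 2. (Intersection.) For every $k\ge 1$, the languages $L_1=\{a^nb^nc^j\mid n,j\ge0\}$ and $L_2=\{a^jb^nc^n\mid n,j\ge 0\}$ are $k$-oscillating, but $L_1\cap L_2$ is not a bounded-oscillation language. Hence neither the $k$-oscillating languages, for any $k\ge 1$, nor the bounded-oscillation languages are closed under intersection. 3. (Complement.) For every $k\ge 0$ there is a $k$-oscillating language over a three-letter alphabet whose complement is not $k$-oscillating, and there is a bounded-oscillation language over a three-letter alphabet whose complement is not a bounded-oscillation language. 4. (Determinism.) The language of even-length palindromes generated by $S\to 0S0\mid 1S1\mid\varepsilon$ is $1$-oscillating but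 is not a DCFL. The Dyck language $L_D$ is a DCFL but is $k$-oscillating for no $k\ge 0$. Hence the two classes are incomparable: not every DCFL is a bounded-oscillation language and, for every $k\ge 1$, not every $k$-oscillating language is a DCFL. -/

import Mathlib

/-! Dyck words are lists over Mathlib's `DyckStep`; the opening letter `ā` is `DyckStep.U` and the
closing letter `a` is `DyckStep.D`. -/

/-- The grammar `S → ā S a S | ε`. -/
def dyckGrammar : ContextFreeGrammar DyckStep where
  NT := Unit
  initial := ()
  rules :=
    { ⟨(), [.terminal .U, .nonterminal (), .terminal .D, .nonterminal ()]⟩,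
      ⟨(), []⟩ }

/-- The Dyck language. -/
def dyckLanguage : Language DyckStep := dyckGrammar.language

/-- The grammar `S → 0 S 0 | 1 S 1 | ε` (with `0 = false`, `1 = true`). -/
def evenPalindromeGrammar : ContextFreeGrammar Bool where
  NT := Unit
  initial := ()
  rules :=
    { ⟨(), [.terminal false, .nonterminal (), .terminal false]⟩,
      ⟨(), [.terminal true, .nonterminal (), .terminal true]⟩,
      ⟨(), []⟩ }

/-- The language of even-length palindromes over a binary alphabet. -/
def evenPalindromes : Language Bool := evenPalindromeGrammar.language

/-- `DyckEmb u w` : the word `u` results from the Dyck word `w` by deleting zero or more matching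
pairs. A Dyck word is either empty or uniquely of the form `ā w₁ a w₂` with `w₁`, `w₂` Dyck words,
where the two displayed letters form a matching pair and the other matching pairs are those of `w₁`
and of `w₂`; each matching pair is either kept or deleted. -/
inductive DyckEmb : List DyckStep → List DyckStep → Prop
  | nil : DyckEmb [] []
  | keep {u₁ u₂ w₁ w₂ : List DyckStep} (h₁ : DyckEmb u₁ w₁) (h₂ : DyckEmb u₂ w₂) :
      DyckEmb (.U :: u₁ ++ .D :: u₂) (.U :: w₁ ++ .D :: w₂)
  | delete {u₁ u₂ w₁ w₂ : List DyckStep} (h₁ : DyckEmb u₁ w₁) (h₂ : DyckEmb u₂ w₂) :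
      DyckEmb (u₁ ++ u₂) (.U :: w₁ ++ .D :: w₂)

/-- The harmonics: `h₀ = ε` and `hᵢ₊₁ = ā hᵢ a ā hᵢ a`. -/
def dyckHarmonic : ℕ → List DyckStep
  | 0 => []
  | i + 1 => .U :: dyckHarmonic i ++ .D :: .U :: dyckHarmonic i ++ [.D]

/-- `q` is the rank of the Dyck word `w`: the greatest order of a harmonic embedded in `w`. -/
def HasDyckRank (w : List DyckStep) (q : ℕ) : Prop :=
  IsGreatest {i : ℕ | DyckEmb (dyckHarmonic i) w} q

/-- A pushdown automaton with input alphabet `T`. An action `(q, b, γ, p, ξ)` stands for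
`(q, b, γ) ↪ (p, ξ)`, where `b = none` means that no input letter is read. -/
structure PDA (T : Type) where
  State : Type
  StackSym : Type
  finite_state : Finite State
  finite_stackSym : Finite StackSym
  actions : Set (State × Option T × StackSym × State × List StackSym)
  finite_actions : actions.Finite
  start : State
  startSym : StackSym

namespace PDA

/-- Instantaneous descriptors; the top of the stack is the head of the list. -/
@[ext]
structure ID {T : Type} (P : PDA T) where
  state : P.State
  tape : List T
  stack : List P.StackSym

/-- The initial descriptor on input `w`. -/
def initial {T : Type} (P : PDA T) (w : List T) : P.ID := ⟨P.start, w, [P.startSym]⟩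

/-- One move of the automaton. -/
inductive Move {T : Type} (P : PDA T) : P.ID → P.ID → Prop
  | mk {q p : P.State} {b : Option T} {γ : P.StackSym} {ξ' : List P.StackSym}
      (h : (q, b, γ, p, ξ') ∈ P.actions) (w : List T) (ξ : List P.StackSym) :
      Move P ⟨q, b.toList ++ w, γ :: ξ⟩ ⟨p, w, ξ' ++ ξ⟩

/-- `r = I₀, …, Iₘ` is a run on `w`: a move sequence that starts in the initial descriptor on `w`
and ends with empty tape and empty stack. -/
def IsRun {T : Type} (P : PDA T) (w : List T) (r : List P.ID) : Prop :=
  r.IsChain P.Move ∧ r.head? = some (P.initial w) ∧ ∃ q : P.State, r.getLast? = some ⟨q, [], []⟩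

/-- The word `α'(r)` of a sequence of descriptors: a move that replaces the top stack symbol by `d`
symbols contributes `a ā ⋯ ā` with `d` letters `ā`. For a move `I ⊢ J` the number `d` is
`|stack J| + 1 - |stack I|`. The lemmas `footprintAux_pop`, `footprintAux_push`,
`footprintAux_glue` and `footprintAux_strip` show that this is the word obtained by recursion on
the disassembly of a quasi-run into its first move and one quasi-run for each symbol pushed. -/
def footprintAux {T : Type} {P : PDA T} : List P.ID → List DyckStep
  | I :: J :: r =>
      (.D :: List.replicate (J.stack.length + 1 - I.stack.length) .U) ++ footprintAux (J :: r)
  | _ => []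

/-- The footprint `α(r) = ā α'(r)`. -/
def footprint {T : Type} {P : PDA T} (r : List P.ID) : List DyckStep := .U :: footprintAux r

theorem footprintAux_pop {T : Type} {P : PDA T} (I J : P.ID) (hI : I.stack.length = 1)
    (hJ : J.stack = []) : footprintAux [I, J] = [.D] := by
  simp [footprintAux, hI, hJ]

theorem footprintAux_push {T : Type} {P : PDA T} (I J : P.ID) (r : List P.ID)
    (hI : I.stack.length = 1) :
    footprintAux (I :: J :: r) =
      (.D :: List.replicate J.stack.length .U) ++ footprintAux (J :: r) := by
  simp [footprintAux, hI]

theorem footprintAux_glue {T : Type} {P : PDA T} (r s : List P.ID) (J : P.ID) :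
    footprintAux (r ++ J :: s) = footprintAux (r ++ [J]) ++ footprintAux (J :: s) := by
  induction r with
  | nil => simp [footprintAux]
  | cons I r ih => cases r <;> simp_all [footprintAux]

theorem footprintAux_strip {T : Type} {P : PDA T} (ξ : List P.StackSym) (r : List P.ID) :
    footprintAux (r.map fun I => (⟨I.state, I.tape, I.stack ++ ξ⟩ : P.ID)) = footprintAux r := by
  induction r with
  | nil => rfl
  | cons I r ih =>
    cases r with
    | nil => rfl
    | cons J r =>
      have h : J.stack.length + ξ.length + 1 - (I.stack.length + ξ.length)
          = J.stack.length + 1 - I.stack.length := by omega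
      simp_all [footprintAux]

/-- `L^{(k)}(P)`: the words accepted by some run whose oscillation (the rank of its footprint)
is exactly `k`. -/
def oscLanguage {T : Type} (P : PDA T) (k : ℕ) : Language T :=
  {w | ∃ r : List P.ID, P.IsRun w r ∧ HasDyckRank (footprint r) k}

/-- No descriptor allows two different moves. -/
structure IsDeterministic {T : Type} (P : PDA T) : Prop where
  unique : ∀ (q : P.State) (b : Option T) (γ : P.StackSym) (p p' : P.State)
    (ξ ξ' : List P.StackSym), (q, b, γ, p, ξ) ∈ P.actions → (q, b, γ, p', ξ') ∈ P.actions →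
      p = p' ∧ ξ = ξ'
  no_choice : ∀ (q : P.State) (b : T) (γ : P.StackSym) (p p' : P.State)
    (ξ ξ' : List P.StackSym), (q, none, γ, p, ξ) ∈ P.actions → (q, some b, γ, p', ξ') ∉ P.actions

/-- The language accepted by final state, with set `F` of final states. -/
def finalLanguage {T : Type} (P : PDA T) (F : Set P.State) : Language T :=
  {w | ∃ q ∈ F, ∃ ξ : List P.StackSym, Relation.ReflTransGen P.Move (P.initial w) ⟨q, [], ξ⟩}

end PDA

/-- `L` is a `k`-oscillating language. -/
def IsOscillating {T : Type} (k : ℕ) (L : Language T) : Prop :=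
  ∃ P : PDA T, L = P.oscLanguage k

/-- `L` is a bounded-oscillation language. -/
def IsBoundedOscillation {T : Type} (L : Language T) : Prop :=
  ∃ k : ℕ, IsOscillating k L

/-- `L` is a deterministic context-free language: it is accepted, by final state, by a
deterministic pushdown automaton. -/
def IsDCFL {T : Type} (L : Language T) : Prop :=
  ∃ (P : PDA T) (F : Set P.State), P.IsDeterministic ∧ L = P.finalLanguage F

/-- `{aⁿ bⁿ cʲ | n, j ≥ 0}` with `a = 0`, `b = 1`, `c = 2`. -/
def langAnBnCj : Language (Fin 3) :=
  {w | ∃ n j : ℕ, w = List.replicate n 0 ++ List.replicate n 1 ++ List.replicate j 2}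

/-- `{aʲ bⁿ cⁿ | n, j ≥ 0}` with `a = 0`, `b = 1`, `c = 2`. -/
def langAjBnCn : Language (Fin 3) :=
  {w | ∃ n j : ℕ, w = List.replicate j 0 ++ List.replicate n 1 ++ List.replicate n 2}

/-! ### A numerical measure of Dyck words -/

/-! The rank of a Dyck word is computed by a finer measure. The value `2 * i` means that `hᵢ` embeds
but `ā hᵢ a` does not, and `2 * i + 1` means that `ā hᵢ a` embeds but `hᵢ₊₁` does not. Enclosing a
word in a pair makes its measure odd. Two adjacent factors with measures in the same block `{2 * m -
1, 2 * m}`, `m > 0`, produce `h_m`; otherwise the larger measure survives. The measure is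
compositional, so runs can be replaced by evaluation trees (`PDA.Eval`) that record the measure
contributed by each stack symbol, and oscillation is read off at the root
(`PDA.mem_oscLanguage_iff`).

Closure under union is a disjoint sum of automata at a fixed `k`. Different `k` are reconciled by
`PDA.lift`, which raises every oscillation by exactly one. Linear languages are `1`-oscillating,
which covers `aⁿbⁿcʲ`, `aʲbⁿcⁿ` and the palindromes.

The negative results on `aⁿbⁿcⁿ` and on the Dyck language rest on `PDA.exists_factorTree`. A word of
a `k`-oscillating language is the yield of a binary tree of Strahler number at most `4 * k + 3`, and
every subtree yield becomes a word of the language after adding boundedly many letters at each end.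
For `aⁿbⁿcⁿ` a subtree yield of suitable length is contradictory. For the Dyck language, words whose
branchings are separated by high slopes force a large Strahler number. Failure under complement
follows from union and intersection by De Morgan, except that `k = 0` is treated directly.

For determinism, a deterministic automaton can be driven to a descriptor below whose top symbol it
never descends. Two prefixes with the same state and top symbol there cannot be separated by
nonempty words, whereas palindromes separate prefixes of different lengths. -/

/-- The measure of a concatenation of two Dyck words in terms of the measures of the factors. -/
def dyckJoin (a b : ℕ) : ℕ := if (a + 1) / 2 = (b + 1) / 2 then 2 * ((a + 1) / 2) else max a b

/-- The measure of `ā u a v` in terms of the measures of `u` and `v`. -/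
def dyckCons (a b : ℕ) : ℕ := dyckJoin (2 * (a / 2) + 1) b

theorem dyckJoin_mono {a b a' b' : ℕ} (ha : a ≤ a') (hb : b ≤ b') :
    dyckJoin a b ≤ dyckJoin a' b' := by
  unfold dyckJoin; split_ifs <;> omega

theorem dyckCons_mono {a b a' b' : ℕ} (ha : a ≤ a') (hb : b ≤ b') :
    dyckCons a b ≤ dyckCons a' b' :=
  dyckJoin_mono (by omega) hb

theorem dyckJoin_assoc (a b c : ℕ) :
    dyckJoin (dyckJoin a b) c = dyckJoin a (dyckJoin b c) := by
  unfold dyckJoin; split_ifs <;> omega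

theorem dyckJoin_zero_left (a : ℕ) : dyckJoin 0 a = a := by
  unfold dyckJoin; split_ifs <;> omega

theorem dyckJoin_zero_right (a : ℕ) : dyckJoin a 0 = a := by
  unfold dyckJoin; split_ifs <;> omega

theorem dyckJoin_le_dyckCons (a b : ℕ) : dyckJoin a b ≤ dyckCons a b :=
  dyckJoin_mono (by omega) le_rfl

theorem dyckJoin_dyckCons (a b c : ℕ) :
    dyckJoin (dyckCons a b) c = dyckCons a (dyckJoin b c) :=
  dyckJoin_assoc _ _ _

theorem le_dyckCons_left (a b : ℕ) : a ≤ dyckCons a b := by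
  unfold dyckCons dyckJoin; split_ifs <;> omega

theorem le_dyckCons_right (a b : ℕ) : b ≤ dyckCons a b := by
  unfold dyckCons dyckJoin; split_ifs <;> omega

theorem dyckCons_pos (a b : ℕ) : 0 < dyckCons a b := by
  unfold dyckCons dyckJoin; split_ifs <;> omega

/-- Evaluation of a word from right to left with a stack of measures: `a` opens a new measure, `ā`
combines the two topmost ones. The empty stack signals failure. -/
def dyckEval : List DyckStep → List ℕ
  | [] => [0]
  | .D :: w =>
    match dyckEval w with
    | [] => []
    | a :: s => 0 :: a :: s
  | .U :: w =>
    match dyckEval w with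
    | a :: b :: s => dyckCons a b :: s
    | _ => []

theorem dyckEval_D {w : List DyckStep} {a : ℕ} {s : List ℕ} (h : dyckEval w = a :: s) :
    dyckEval (.D :: w) = 0 :: a :: s := by
  simp [dyckEval, h]

theorem dyckEval_U {w : List DyckStep} {a b : ℕ} {s : List ℕ} (h : dyckEval w = a :: b :: s) :
    dyckEval (.U :: w) = dyckCons a b :: s := by
  simp [dyckEval, h]

/-- The letters `ā` of one push open nested pairs, the innermost around the empty word when `a = 0`,
and the contributions of the pushed symbols follow the successive closing letters. Hence the left
fold, the same as in `PDA.Eval.cons`. -/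
theorem dyckEval_replicate_U (ms : List ℕ) :
    ∀ (w : List DyckStep) (a : ℕ) (s : List ℕ), dyckEval w = a :: (ms ++ s) →
      dyckEval (List.replicate ms.length .U ++ w) = ms.foldl dyckCons a :: s := by
  induction ms with
  | nil => intro w a s h; simpa using h
  | cons b ms ih =>
    intro w a s h
    have := ih (.U :: w) (dyckCons a b) s (dyckEval_U h)
    rw [List.length_cons, List.replicate_succ', List.append_assoc]
    exact this

/-- `w` is a Dyck word of measure `a`. -/
inductive DyckMeasure : List DyckStep → ℕ → Prop
  | nil : DyckMeasure [] 0
  | node {u v : List DyckStep} {a b : ℕ} (hu : DyckMeasure u a) (hv : DyckMeasure v b) :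
      DyckMeasure (.U :: u ++ .D :: v) (dyckCons a b)

/-- The arbitrary right context makes the induction work; evaluation then yields uniqueness of the
measure without an argument about unique parsing. -/
theorem DyckMeasure.eval_append {u : List DyckStep} {a : ℕ} (h : DyckMeasure u a) :
    ∀ (w : List DyckStep) (x : ℕ) (s : List ℕ), dyckEval w = x :: s →
      dyckEval (u ++ w) = dyckJoin a x :: s := by
  induction h with
  | nil => intro w x s h; simpa [dyckJoin_zero_left] using h
  | node _ _ ihu ihv =>
    intro w x s h
    have h1 := ihu _ _ _ (dyckEval_D (ihv _ _ _ h))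
    rw [dyckJoin_zero_right] at h1
    have h2 := dyckEval_U h1
    rw [dyckJoin_dyckCons]
    simpa using h2

theorem DyckMeasure.eval {u : List DyckStep} {a : ℕ} (h : DyckMeasure u a) :
    dyckEval u = [a] := by
  simpa [dyckJoin_zero_right] using h.eval_append [] 0 [] rfl

theorem DyckMeasure.unique {u : List DyckStep} {a b : ℕ} (h : DyckMeasure u a)
    (h' : DyckMeasure u b) : a = b := by
  simpa using h.eval.symm.trans h'.eval

theorem DyckMeasure.append {u v : List DyckStep} {a b : ℕ} (hu : DyckMeasure u a)
    (hv : DyckMeasure v b) : DyckMeasure (u ++ v) (dyckJoin a b) := by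
  induction hu with
  | nil => simpa [dyckJoin_zero_left] using hv
  | node hu _ _ ih =>
    rw [dyckJoin_dyckCons]
    simpa using DyckMeasure.node hu ih

/-- The words `u₀ a u₁ a ⋯ a uₙ` with Dyck words `uᵢ` of the measures given by the list. -/
inductive DyckSuffix : List DyckStep → List ℕ → Prop
  | single {u : List DyckStep} {a : ℕ} (hu : DyckMeasure u a) : DyckSuffix u [a]
  | cons {u w : List DyckStep} {a : ℕ} {s : List ℕ} (hu : DyckMeasure u a) (hw : DyckSuffix w s) :
      DyckSuffix (u ++ .D :: w) (a :: s)

/-- The entries of a stack belong to the stretches between unmatched closing letters. A stack with a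
single entry thus certifies a Dyck word. -/
theorem dyckSuffix_eval : ∀ (w : List DyckStep), dyckEval w ≠ [] → DyckSuffix w (dyckEval w)
  | [], _ => .single .nil
  | .D :: w, h => by
    rcases hw : dyckEval w with _ | ⟨a, s⟩
    · simp [dyckEval, hw] at h
    · have ih := dyckSuffix_eval w (by simp [hw])
      rw [dyckEval_D hw]
      rw [hw] at ih
      exact DyckSuffix.cons .nil ih
  | .U :: w, h => by
    rcases hw : dyckEval w with _ | ⟨a, _ | ⟨b, s⟩⟩
    · simp [dyckEval, hw] at h
    · simp [dyckEval, hw] at h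
    · have ih := dyckSuffix_eval w (by simp [hw])
      rw [dyckEval_U hw]
      rw [hw] at ih
      cases ih with
      | cons hu hv =>
        cases hv with
        | single hv => exact .single (.node hu hv)
        | cons hv ht => simpa using DyckSuffix.cons (.node hu hv) ht

theorem dyckMeasure_of_eval {w : List DyckStep} {a : ℕ} (h : dyckEval w = [a]) :
    DyckMeasure w a := by
  have := dyckSuffix_eval w (by simp [h])
  rw [h] at this
  cases this with
  | single hu => exact hu
  | cons _ hw => cases hw

/-! ### The measure determines the rank. -/

/-- Deleting a pair replaces `dyckCons` by the smaller `dyckJoin`, and both are monotone. -/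
theorem DyckEmb.measure_le {u w : List DyckStep} (h : DyckEmb u w) :
    ∃ a b, DyckMeasure u a ∧ DyckMeasure w b ∧ a ≤ b := by
  induction h with
  | nil => exact ⟨0, 0, .nil, .nil, le_rfl⟩
  | keep _ _ ih₁ ih₂ =>
    obtain ⟨a, b, hu, hw, hab⟩ := ih₁
    obtain ⟨a', b', hu', hw', hab'⟩ := ih₂
    exact ⟨_, _, .node hu hu', .node hw hw', dyckCons_mono hab hab'⟩
  | delete _ _ ih₁ ih₂ =>
    obtain ⟨a, b, hu, hw, hab⟩ := ih₁
    obtain ⟨a', b', hu', hw', hab'⟩ := ih₂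
    exact ⟨_, _, hu.append hu', .node hw hw',
      (dyckJoin_mono hab hab').trans (dyckJoin_le_dyckCons _ _)⟩

theorem dyckMeasure_harmonic (i : ℕ) : DyckMeasure (dyckHarmonic i) (2 * i) := by
  induction i with
  | zero => exact .nil
  | succ i ih =>
    have h := DyckMeasure.node ih (DyckMeasure.node ih .nil)
    have e : dyckCons (2 * i) (dyckCons (2 * i) 0) = 2 * (i + 1) := by
      unfold dyckCons dyckJoin; split_ifs <;> omega
    rw [e] at h
    simpa [dyckHarmonic] using h

theorem DyckMeasure.dyckEmb_nil {w : List DyckStep} {a : ℕ} (h : DyckMeasure w a) :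
    DyckEmb [] w := by
  induction h with
  | nil => exact .nil
  | node _ _ ih₁ ih₂ => exact DyckEmb.delete ih₁ ih₂

/-- Even and odd values must be treated together: `hⱼ₊₁` is assembled from `hⱼ` inside the outer
pair and a copy of `ā hⱼ a` to its right. -/
theorem DyckMeasure.dyckEmb {w : List DyckStep} {a : ℕ} (h : DyckMeasure w a) :
    (∀ i, 2 * i ≤ a → DyckEmb (dyckHarmonic i) w) ∧
      ∀ i, 2 * i + 1 ≤ a → DyckEmb (.U :: dyckHarmonic i ++ [.D]) w := by
  induction h with
  | nil =>
    refine ⟨fun i hi => ?_, fun i hi => by omega⟩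
    obtain rfl : i = 0 := by omega
    exact .nil
  | @node u v a b hu hv ihu ihv =>
    have right : ∀ x, DyckEmb x v → DyckEmb x (.U :: u ++ .D :: v) := fun x hx =>
      DyckEmb.delete hu.dyckEmb_nil hx
    have left : ∀ x, DyckEmb x u → DyckEmb x (.U :: u ++ .D :: v) := fun x hx => by
      simpa using DyckEmb.delete hx hv.dyckEmb_nil
    refine ⟨fun i hi => ?_, fun i hi => ?_⟩
    · by_cases h1 : 2 * i ≤ b
      · exact right _ (ihv.1 i h1)
      by_cases h2 : 2 * i ≤ a
      · exact left _ (ihu.1 i h2)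
      obtain ⟨j, rfl⟩ : ∃ j, i = j + 1 := ⟨i - 1, by omega⟩
      have h3 : 2 * j ≤ a ∧ 2 * j + 1 ≤ b := by
        revert hi; unfold dyckCons dyckJoin; split_ifs <;> omega
      have := DyckEmb.keep (ihu.1 j h3.1) (ihv.2 j h3.2)
      simpa [dyckHarmonic] using this
    · by_cases h1 : 2 * i + 1 ≤ b
      · exact right _ (ihv.2 i h1)
      have h3 : 2 * i ≤ a := by
        revert hi; unfold dyckCons dyckJoin; split_ifs <;> omega
      exact DyckEmb.keep (ihu.1 i h3) hv.dyckEmb_nil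

theorem DyckMeasure.dyckEmb_harmonic_iff {w : List DyckStep} {a : ℕ} (h : DyckMeasure w a)
    (i : ℕ) : DyckEmb (dyckHarmonic i) w ↔ 2 * i ≤ a := by
  refine ⟨fun hi => ?_, h.dyckEmb.1 i⟩
  obtain ⟨x, y, hx, hy, hxy⟩ := hi.measure_le
  rwa [← hy.unique h, ← hx.unique (dyckMeasure_harmonic i)]

theorem DyckMeasure.hasDyckRank_iff {w : List DyckStep} {a : ℕ} (h : DyckMeasure w a) (k : ℕ) :
    HasDyckRank w k ↔ a / 2 = k := by
  unfold HasDyckRank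
  constructor
  · rintro ⟨h1, h2⟩
    have h3 := (h.dyckEmb_harmonic_iff k).1 h1
    have h4 := h2 ((h.dyckEmb_harmonic_iff (a / 2)).2 (by omega))
    omega
  · rintro rfl
    refine ⟨(h.dyckEmb_harmonic_iff _).2 (by omega), fun i hi => ?_⟩
    have := (h.dyckEmb_harmonic_iff i).1 hi
    omega

theorem le_foldl_dyckCons (ms : List ℕ) : ∀ a : ℕ, a ≤ ms.foldl dyckCons a := by
  induction ms with
  | nil => exact fun _ => le_rfl
  | cons c ms ih => exact fun a => (le_dyckCons_left a c).trans (ih _)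

theorem mem_le_foldl_dyckCons {ms : List ℕ} {x : ℕ} (hx : x ∈ ms) :
    ∀ a : ℕ, x ≤ ms.foldl dyckCons a := by
  induction ms with
  | nil => simp at hx
  | cons c ms ih =>
    intro a
    rcases List.mem_cons.1 hx with rfl | hx
    · exact (le_dyckCons_right a x).trans (le_foldl_dyckCons ms _)
    · exact ih hx _

/-! ### Evaluation trees of runs -/

namespace PDA

variable {T : Type}

/-- `P.Eval q ξ w p ms`: from state `q` the automaton can consume the stack `ξ` while reading `w`,
ending in state `p`; the list `ms` holds, for each symbol of `ξ`, the measure of the Dyck word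
contributed by its removal (without the letter `a` of the first move). -/
inductive Eval (P : PDA T) :
    P.State → List P.StackSym → List T → P.State → List ℕ → Prop
  | nil (q : P.State) : Eval P q [] [] q []
  | cons {q p₁ p₂ p : P.State} {b : Option T} {γ : P.StackSym} {ξ' ξ : List P.StackSym}
      {w₁ w₂ : List T} {ms' ms : List ℕ} (h : (q, b, γ, p₁, ξ') ∈ P.actions)
      (h₁ : Eval P p₁ ξ' w₁ p₂ ms') (h₂ : Eval P p₂ ξ w₂ p ms) :
      Eval P q (γ :: ξ) (b.toList ++ (w₁ ++ w₂)) p (ms'.foldl dyckCons 0 :: ms)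

theorem Eval.length_eq {P : PDA T} {q p : P.State} {ξ : List P.StackSym} {w : List T}
    {ms : List ℕ} (h : P.Eval q ξ w p ms) : ms.length = ξ.length := by
  induction h with
  | nil => rfl
  | cons _ _ _ _ ih => simp [ih]

theorem Eval.append {P : PDA T} {q p p' : P.State} {ξ ξ' : List P.StackSym} {w w' : List T}
    {ms ms' : List ℕ} (h : P.Eval q ξ w p ms) (h' : P.Eval p ξ' w' p' ms') :
    P.Eval q (ξ ++ ξ') (w ++ w') p' (ms ++ ms') := by
  induction h with
  | nil => exact h'
  | cons ha h₁ _ _ ih => simpa using Eval.cons ha h₁ (ih h')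

theorem Eval.split {P : PDA T} {p : P.State} {ξ₂ : List P.StackSym} (ξ₁ : List P.StackSym) :
    ∀ {q : P.State} {w : List T} {ms : List ℕ}, P.Eval q (ξ₁ ++ ξ₂) w p ms →
      ∃ (p' : P.State) (w₁ w₂ : List T) (ms₁ ms₂ : List ℕ), w = w₁ ++ w₂ ∧ ms = ms₁ ++ ms₂ ∧
        P.Eval q ξ₁ w₁ p' ms₁ ∧ P.Eval p' ξ₂ w₂ p ms₂ := by
  induction ξ₁ with
  | nil => exact fun {q w ms} h => ⟨q, [], w, [], ms, rfl, rfl, .nil q, h⟩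
  | cons γ ξ₁ ih =>
    intro q w ms h
    cases h with
    | cons ha h₁ h₂ =>
      obtain ⟨p', w₁, w₂, ms₁, ms₂, rfl, rfl, h3, h4⟩ := ih h₂
      exact ⟨p', _, w₂, _, ms₂, by simp, by simp, .cons ha h₁ h3, h4⟩

/-- Each stack symbol owns one entry of `ms`. The extra `0` in front is what is opened by the
closing letter of the next move, or, at the end of the run, the value of the empty word. -/
theorem Eval.of_run {P : PDA T} {p : P.State} (r : List P.ID) :
    ∀ I : P.ID, (I :: r).IsChain P.Move → (I :: r).getLast? = some ⟨p, [], []⟩ →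
      ∃ ms, P.Eval I.state I.stack I.tape p ms ∧ dyckEval (footprintAux (I :: r)) = 0 :: ms := by
  induction r with
  | nil =>
    intro I _ hl
    simp only [List.getLast?_singleton, Option.some.injEq] at hl
    subst hl
    exact ⟨[], .nil p, rfl⟩
  | cons J r ih =>
    intro I hc hl
    rw [List.isChain_cons_cons] at hc
    rw [List.getLast?_cons_cons] at hl
    obtain ⟨ms, hE, hM⟩ := ih J hc.2 hl
    obtain ⟨hmove, -⟩ := hc
    cases hmove with
    | @mk q p₁ b γ ξ' ha w ξ =>
      obtain ⟨p', w₁, w₂, ms₁, ms₂, rfl, rfl, h3, h4⟩ := Eval.split ξ' hE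
      refine ⟨_, .cons ha h3 h4, ?_⟩
      have hlen : (ξ' ++ ξ).length + 1 - (γ :: ξ).length = ms₁.length := by
        rw [h3.length_eq]; simp only [List.length_append, List.length_cons]; omega
      rw [footprintAux, hlen]
      exact dyckEval_D (dyckEval_replicate_U _ _ _ _ hM)

/-- The statement extends a given continuation backwards, so that at a node the right subtree is
prepended before the left one and no runs need to be glued. -/
theorem Eval.exists_run {P : PDA T} {q p : P.State} {ξ : List P.StackSym} {w : List T}
    {ms : List ℕ} (h : P.Eval q ξ w p ms) :
    ∀ (w' : List T) (ζ : List P.StackSym) (ms' : List ℕ) (r : List P.ID) (l : Option P.ID),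
      (⟨p, w', ζ⟩ :: r : List P.ID).IsChain P.Move →
      (⟨p, w', ζ⟩ :: r : List P.ID).getLast? = l →
      dyckEval (footprintAux (⟨p, w', ζ⟩ :: r : List P.ID)) = 0 :: ms' →
      ∃ r' : List P.ID, (⟨q, w ++ w', ξ ++ ζ⟩ :: r' : List P.ID).IsChain P.Move ∧
        (⟨q, w ++ w', ξ ++ ζ⟩ :: r' : List P.ID).getLast? = l ∧
        dyckEval (footprintAux (⟨q, w ++ w', ξ ++ ζ⟩ :: r' : List P.ID)) = 0 :: (ms ++ ms') := by
  induction h with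
  | nil q => exact fun w' ζ ms' r l h1 h2 h3 => ⟨r, h1, h2, h3⟩
  | @cons q p₁ p₂ p b γ ξ' ξ w₁ w₂ ms₁ ms ha e₁ e₂ ih₁ ih₂ =>
    intro w' ζ ms' r l h1 h2 h3
    obtain ⟨r₂, h1, h2, h3⟩ := ih₂ w' ζ ms' r l h1 h2 h3
    obtain ⟨r₁, h1, h2, h3⟩ := ih₁ _ _ _ _ _ h1 h2 h3
    refine ⟨⟨p₁, w₁ ++ (w₂ ++ w'), ξ' ++ (ξ ++ ζ)⟩ :: r₁, ?_, ?_, ?_⟩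
    · rw [List.isChain_cons_cons]
      refine ⟨?_, h1⟩
      simpa using Move.mk ha (w₁ ++ (w₂ ++ w')) (ξ ++ ζ)
    · rw [List.getLast?_cons_cons]; exact h2
    · have hlen : (ξ' ++ (ξ ++ ζ)).length + 1 - (γ :: ξ ++ ζ).length = ms₁.length := by
        rw [e₁.length_eq]; simp only [List.length_append, List.length_cons]; omega
      rw [footprintAux, hlen]
      exact dyckEval_D (dyckEval_replicate_U _ _ _ _ h3)

theorem mem_oscLanguage_iff {P : PDA T} {k : ℕ} {w : List T} :
    w ∈ P.oscLanguage k ↔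
      ∃ (p : P.State) (x : ℕ), P.Eval P.start [P.startSym] w p [x] ∧ dyckCons 0 x / 2 = k := by
  constructor
  · rintro ⟨r, ⟨hc, hh, p, hl⟩, hk⟩
    obtain _ | ⟨I, r⟩ := r
    · simp at hh
    simp only [List.head?_cons, Option.some.injEq] at hh
    subst hh
    obtain ⟨ms, hE, hM⟩ := Eval.of_run r _ hc hl
    obtain ⟨x, rfl⟩ := List.length_eq_one_iff.1 (hE.length_eq.trans (by rfl))
    exact ⟨p, x, hE, ((dyckMeasure_of_eval (dyckEval_U hM)).hasDyckRank_iff k).1 hk⟩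
  · rintro ⟨p, x, hE, hk⟩
    obtain ⟨r, h1, h2, h3⟩ := hE.exists_run [] [] [] [] _ (by simp) rfl rfl
    simp only [List.append_nil] at h1 h2 h3
    exact ⟨_, ⟨h1, rfl, p, h2⟩, ((dyckMeasure_of_eval (dyckEval_U h3)).hasDyckRank_iff k).2 hk⟩

end PDA

/-! ### Union -/

namespace PDA

variable {T : Type}

theorem Eval.nil_inv {P : PDA T} {q p : P.State} {w : List T} {ms : List ℕ}
    (h : P.Eval q [] w p ms) : p = q ∧ w = [] ∧ ms = [] := by
  cases h; exact ⟨rfl, rfl, rfl⟩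

theorem eval_singleton_iff {P : PDA T} {q p : P.State} {γ : P.StackSym} {w : List T} {x : ℕ} :
    P.Eval q [γ] w p [x] ↔ ∃ (b : Option T) (p₁ : P.State) (ξ : List P.StackSym) (w₁ : List T)
      (ms : List ℕ), (q, b, γ, p₁, ξ) ∈ P.actions ∧ P.Eval p₁ ξ w₁ p ms ∧ w = b.toList ++ w₁ ∧
        x = ms.foldl dyckCons 0 := by
  constructor
  · intro h
    cases h with
    | cons ha h₁ h₂ =>
      obtain ⟨rfl, rfl, -⟩ := h₂.nil_inv
      exact ⟨_, _, _, _, _, ha, h₁, by simp, rfl⟩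
  · rintro ⟨b, p₁, ξ, w₁, ms, ha, h₁, rfl, rfl⟩
    simpa using Eval.cons ha h₁ (.nil p)

theorem Eval.map {P P' : PDA T} (f : P.State → P'.State) (g : P.StackSym → P'.StackSym)
    (hfg : ∀ q b γ p ξ, (q, b, γ, p, ξ) ∈ P.actions → (f q, b, g γ, f p, ξ.map g) ∈ P'.actions)
    {q p : P.State} {ξ : List P.StackSym} {w : List T} {ms : List ℕ} (h : P.Eval q ξ w p ms) :
    P'.Eval (f q) (ξ.map g) w (f p) ms := by
  induction h with
  | nil => exact .nil _
  | cons ha _ _ ih₁ ih₂ => exact .cons (hfg _ _ _ _ _ ha) ih₁ ih₂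

/-- An evaluation that starts in the image of `f` and `g` never leaves it, since the hypothesis
pulls back every action available there. -/
theorem Eval.of_map {P P' : PDA T} (f : P.State → P'.State) (g : P.StackSym → P'.StackSym)
    (hfg : ∀ q b γ p' ξ', (f q, b, g γ, p', ξ') ∈ P'.actions →
      ∃ p ξ, p' = f p ∧ ξ' = ξ.map g ∧ (q, b, γ, p, ξ) ∈ P.actions)
    {q' p' : P'.State} {ξ' : List P'.StackSym} {w : List T} {ms : List ℕ}
    (h : P'.Eval q' ξ' w p' ms) :
    ∀ q ξ, q' = f q → ξ' = ξ.map g → ∃ p, p' = f p ∧ P.Eval q ξ w p ms := by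
  induction h with
  | nil =>
    intro q ξ hq hξ
    obtain rfl := List.map_eq_nil_iff.1 hξ.symm
    exact ⟨q, hq, .nil q⟩
  | cons ha _ _ ih₁ ih₂ =>
    intro q ξ hq hξ
    obtain ⟨γ, ξ, rfl, rfl, rfl⟩ := List.map_eq_cons_iff.1 hξ.symm
    subst hq
    obtain ⟨p₁, ξ₁, rfl, rfl, ha'⟩ := hfg _ _ _ _ _ ha
    obtain ⟨p₂, rfl, h₁⟩ := ih₁ _ _ rfl rfl
    obtain ⟨p, rfl, h₂⟩ := ih₂ _ _ rfl rfl
    exact ⟨p, rfl, .cons ha' h₁ h₂⟩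

/-- The disjoint union of two automata, with a fresh start state and a fresh start symbol that
copy the initial moves of both. -/
abbrev union (P₁ P₂ : PDA T) : PDA T where
  State := Option (P₁.State ⊕ P₂.State)
  StackSym := Option (P₁.StackSym ⊕ P₂.StackSym)
  finite_state := by
    have := P₁.finite_state
    have := P₂.finite_state
    infer_instance
  finite_stackSym := by
    have := P₁.finite_stackSym
    have := P₂.finite_stackSym
    infer_instance
  actions :=
    ((fun α => (some (.inl α.1), α.2.1, some (.inl α.2.2.1), some (.inl α.2.2.2.1),
        α.2.2.2.2.map fun γ => some (.inl γ))) '' P₁.actions ∪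
      (fun α => (some (.inr α.1), α.2.1, some (.inr α.2.2.1), some (.inr α.2.2.2.1),
        α.2.2.2.2.map fun γ => some (.inr γ))) '' P₂.actions) ∪
    ((fun α => (none, α.2.1, none, some (.inl α.2.2.2.1),
        α.2.2.2.2.map fun γ => some (.inl γ))) ''
          {α ∈ P₁.actions | α.1 = P₁.start ∧ α.2.2.1 = P₁.startSym} ∪
      (fun α => (none, α.2.1, none, some (.inr α.2.2.2.1),
        α.2.2.2.2.map fun γ => some (.inr γ))) ''
          {α ∈ P₂.actions | α.1 = P₂.start ∧ α.2.2.1 = P₂.startSym})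
  finite_actions :=
    ((P₁.finite_actions.image _).union (P₂.finite_actions.image _)).union
      (((P₁.finite_actions.subset (Set.sep_subset _ _)).image _).union
        ((P₂.finite_actions.subset (Set.sep_subset _ _)).image _))
  start := none
  startSym := none

theorem union_eval_inl_iff (P₁ P₂ : PDA T) (q : P₁.State) (ξ : List P₁.StackSym) (w : List T)
    (p' : (P₁.union P₂).State) (ms : List ℕ) :
    (P₁.union P₂).Eval (some (.inl q)) (ξ.map fun γ => some (.inl γ)) w p' ms ↔
      ∃ p, p' = some (.inl p) ∧ P₁.Eval q ξ w p ms := by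
  constructor
  · intro h
    refine h.of_map (P := P₁) (fun q => some (.inl q)) (fun γ => some (.inl γ)) ?_ q ξ rfl rfl
    rintro q b γ p' ξ' ((⟨α, hα, h⟩ | ⟨α, hα, h⟩) | (⟨α, hα, h⟩ | ⟨α, hα, h⟩))
    · obtain ⟨q₀, b₀, γ₀, p₀, ξ₀⟩ := α
      simp only [Prod.mk.injEq, Option.some.injEq, Sum.inl.injEq] at h
      obtain ⟨rfl, rfl, rfl, rfl, rfl⟩ := h
      exact ⟨_, _, rfl, rfl, hα⟩
    all_goals simp at h
  · rintro ⟨p, rfl, h⟩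
    exact h.map (P' := P₁.union P₂) (fun q => some (.inl q)) (fun γ => some (.inl γ))
      fun q b γ p ξ ha => .inl (.inl ⟨_, ha, rfl⟩)

theorem union_eval_inr_iff (P₁ P₂ : PDA T) (q : P₂.State) (ξ : List P₂.StackSym) (w : List T)
    (p' : (P₁.union P₂).State) (ms : List ℕ) :
    (P₁.union P₂).Eval (some (.inr q)) (ξ.map fun γ => some (.inr γ)) w p' ms ↔
      ∃ p, p' = some (.inr p) ∧ P₂.Eval q ξ w p ms := by
  constructor
  · intro h
    refine h.of_map (P := P₂) (fun q => some (.inr q)) (fun γ => some (.inr γ)) ?_ q ξ rfl rfl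
    rintro q b γ p' ξ' ((⟨α, hα, h⟩ | ⟨α, hα, h⟩) | (⟨α, hα, h⟩ | ⟨α, hα, h⟩))
    · simp at h
    · obtain ⟨q₀, b₀, γ₀, p₀, ξ₀⟩ := α
      simp only [Prod.mk.injEq, Option.some.injEq, Sum.inr.injEq] at h
      obtain ⟨rfl, rfl, rfl, rfl, rfl⟩ := h
      exact ⟨_, _, rfl, rfl, hα⟩
    all_goals simp at h
  · rintro ⟨p, rfl, h⟩
    exact h.map (P' := P₁.union P₂) (fun q => some (.inr q)) (fun γ => some (.inr γ))
      fun q b γ p ξ ha => .inl (.inr ⟨_, ha, rfl⟩)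

/-- Since the fresh symbol imitates a first move instead of preceding it, every evaluation tree
keeps its measures and the oscillation is preserved exactly. -/
theorem oscLanguage_union (P₁ P₂ : PDA T) (k : ℕ) :
    (P₁.union P₂).oscLanguage k = P₁.oscLanguage k ⊔ P₂.oscLanguage k := by
  ext w
  have hsup : w ∈ P₁.oscLanguage k ⊔ P₂.oscLanguage k ↔
    w ∈ P₁.oscLanguage k ∨ w ∈ P₂.oscLanguage k := Iff.rfl
  rw [hsup]
  simp only [mem_oscLanguage_iff]
  constructor
  · rintro ⟨p, x, h, hk⟩
    obtain ⟨b, p₁, ξ, w₁, ms, ha, h₁, rfl, rfl⟩ := eval_singleton_iff.1 h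
    obtain ((⟨α, hα, h⟩ | ⟨α, hα, h⟩) | (⟨⟨q₀, b₀, γ₀, p₀, ξ₀⟩, ⟨hα, h3, h4⟩, h⟩ |
      ⟨⟨q₀, b₀, γ₀, p₀, ξ₀⟩, ⟨hα, h3, h4⟩, h⟩)) := ha
    · simp [union] at h
    · simp [union] at h
    · simp only [Prod.mk.injEq] at h
      obtain ⟨-, rfl, -, rfl, rfl⟩ := h
      obtain ⟨p, rfl, h₂⟩ := (union_eval_inl_iff P₁ P₂ _ _ _ _ _).1 h₁
      obtain rfl : q₀ = P₁.start := h3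
      obtain rfl : γ₀ = P₁.startSym := h4
      exact .inl ⟨p, _, eval_singleton_iff.2 ⟨_, _, _, _, _, hα, h₂, rfl, rfl⟩, hk⟩
    · simp only [Prod.mk.injEq] at h
      obtain ⟨-, rfl, -, rfl, rfl⟩ := h
      obtain ⟨p, rfl, h₂⟩ := (union_eval_inr_iff P₁ P₂ _ _ _ _ _).1 h₁
      obtain rfl : q₀ = P₂.start := h3
      obtain rfl : γ₀ = P₂.startSym := h4
      exact .inr ⟨p, _, eval_singleton_iff.2 ⟨_, _, _, _, _, hα, h₂, rfl, rfl⟩, hk⟩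
  · rintro (⟨p, x, h, hk⟩ | ⟨p, x, h, hk⟩) <;>
      obtain ⟨b, p₁, ξ, w₁, ms, ha, h₁, rfl, rfl⟩ := eval_singleton_iff.1 h
    · exact ⟨_, _, eval_singleton_iff.2 ⟨_, _, _, _, _, .inr (.inl ⟨_, ⟨ha, rfl, rfl⟩, rfl⟩),
        (union_eval_inl_iff P₁ P₂ _ _ _ _ _).2 ⟨p, rfl, h₁⟩, rfl, rfl⟩, hk⟩
    · exact ⟨_, _, eval_singleton_iff.2 ⟨_, _, _, _, _, .inr (.inr ⟨_, ⟨ha, rfl, rfl⟩, rfl⟩),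
        (union_eval_inr_iff P₁ P₂ _ _ _ _ _).2 ⟨p, rfl, h₁⟩, rfl, rfl⟩, hk⟩

/-! ### Raising the oscillation by one -/

/-- The effect of raising the oscillation on the measure contributed by a stack symbol. -/
def liftMeasure (x : ℕ) : ℕ := if x = 0 then 0 else x + 2

/-- The join commutes with a shift of both arguments by two. The value `0` is exempt because an
empty push carries no marker, and there `0` is neutral. -/
theorem dyckCons_liftMeasure (a b : ℕ) :
    dyckCons (a + 2) (liftMeasure b) = dyckCons a b + 2 := by
  unfold dyckCons dyckJoin liftMeasure; split_ifs <;> omega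

theorem foldl_map_liftMeasure (ms : List ℕ) : ∀ a : ℕ,
    (ms.map liftMeasure).foldl dyckCons (a + 2) = ms.foldl dyckCons a + 2 := by
  induction ms with
  | nil => exact fun _ => rfl
  | cons b ms ih =>
    intro a
    rw [List.map_cons, List.foldl_cons, dyckCons_liftMeasure, ih, List.foldl_cons]

/-- The stack of `P.lift` that corresponds to a word pushed by `P`: a nonempty word gets the marker
`inr 0` on top. -/
def liftPush {Γ : Type} : List Γ → List (Γ ⊕ Fin 3)
  | [] => []
  | γ :: ξ => .inr 0 :: (γ :: ξ).map .inl

/-- The automaton that does what `P` does, except that it puts a marker on top of every nonempty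
word it pushes and removes the marker in two moves. The stack symbol `inr 2` is a fresh start
symbol. -/
abbrev lift (P : PDA T) : PDA T where
  State := P.State
  StackSym := P.StackSym ⊕ Fin 3
  finite_state := P.finite_state
  finite_stackSym := by
    have := P.finite_stackSym
    infer_instance
  actions :=
    ((fun α => (α.1, α.2.1, .inl α.2.2.1, α.2.2.2.1, liftPush α.2.2.2.2)) '' P.actions ∪
      Set.range (fun q : P.State => (q, none, .inr 0, q, [.inr 1]))) ∪
    (Set.range (fun q : P.State => (q, none, .inr 1, q, [])) ∪
      {(P.start, none, .inr 2, P.start, liftPush [P.startSym])})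
  finite_actions := by
    have := P.finite_state
    exact ((P.finite_actions.image _).union (Set.finite_range _)).union
      ((Set.finite_range _).union (Set.finite_singleton _))
  start := P.start
  startSym := .inr 2

theorem lift_action_inl_iff {P : PDA T} {q p : P.State} {b : Option T} {γ : P.StackSym}
    {ξ' : List (P.StackSym ⊕ Fin 3)} : (q, b, .inl γ, p, ξ') ∈ P.lift.actions ↔
      ∃ ξ, ξ' = liftPush ξ ∧ (q, b, γ, p, ξ) ∈ P.actions := by
  simp only [lift, Set.mem_union, Set.mem_image, Set.mem_range, Set.mem_singleton_iff,
    Prod.mk.injEq, Prod.exists]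
  aesop

theorem lift_action_zero_iff {P : PDA T} {q p : P.State} {b : Option T}
    {ξ' : List (P.StackSym ⊕ Fin 3)} : (q, b, .inr 0, p, ξ') ∈ P.lift.actions ↔
      b = none ∧ p = q ∧ ξ' = [.inr 1] := by
  simp only [lift, Set.mem_union, Set.mem_image, Set.mem_range, Set.mem_singleton_iff,
    Prod.mk.injEq, Prod.exists]
  aesop

theorem lift_action_one_iff {P : PDA T} {q p : P.State} {b : Option T}
    {ξ' : List (P.StackSym ⊕ Fin 3)} : (q, b, .inr 1, p, ξ') ∈ P.lift.actions ↔
      b = none ∧ p = q ∧ ξ' = [] := by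
  simp only [lift, Set.mem_union, Set.mem_image, Set.mem_range, Set.mem_singleton_iff,
    Prod.mk.injEq, Prod.exists]
  aesop

theorem lift_action_two_iff {P : PDA T} {q p : P.State} {b : Option T}
    {ξ' : List (P.StackSym ⊕ Fin 3)} : (q, b, .inr 2, p, ξ') ∈ P.lift.actions ↔
      q = P.start ∧ b = none ∧ p = P.start ∧ ξ' = liftPush [P.startSym] := by
  simp only [lift, Set.mem_union, Set.mem_image, Set.mem_range, Set.mem_singleton_iff,
    Prod.mk.injEq, Prod.exists]
  aesop

/-- The two removing moves contribute `dyckCons 0 0 = 1`. As `dyckCons 0 1 = 2`, the fold over a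
marked word effectively starts at `2` instead of `0`. -/
theorem lift_eval_marker_iff {P : PDA T} {q p : P.lift.State} {ξ : List P.lift.StackSym}
    {w : List T} {ms : List ℕ} : P.lift.Eval q (.inr 0 :: ξ) w p ms ↔
      ∃ ms', ms = 1 :: ms' ∧ P.lift.Eval q ξ w p ms' := by
  constructor
  · intro h
    cases h with
    | cons ha h₁ h₂ =>
      obtain ⟨rfl, rfl, rfl⟩ := lift_action_zero_iff.1 ha
      cases h₁ with
      | cons ha' h₃ h₄ =>
        obtain ⟨rfl, rfl, rfl⟩ := lift_action_one_iff.1 ha'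
        obtain ⟨rfl, rfl, rfl⟩ := h₃.nil_inv
        obtain ⟨rfl, rfl, rfl⟩ := h₄.nil_inv
        exact ⟨_, rfl, h₂⟩
  · rintro ⟨ms', rfl, h⟩
    have h1 : P.lift.Eval q [.inr 1] [] q [0] :=
      .cons (b := none) (lift_action_one_iff.2 ⟨rfl, rfl, rfl⟩) (.nil q) (.nil q)
    exact .cons (b := none) (lift_action_zero_iff.2 ⟨rfl, rfl, rfl⟩) h1 h

theorem liftMeasure_foldl {P : PDA T} {q p : P.State} {ξ : List P.StackSym} {w : List T}
    {ms : List ℕ} (h : P.lift.Eval q (ξ.map .inl) w p (ms.map liftMeasure)) :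
    ∃ ms', P.lift.Eval q (liftPush ξ) w p ms' ∧
      ms'.foldl dyckCons 0 = liftMeasure (ms.foldl dyckCons 0) := by
  have hlen := h.length_eq
  obtain _ | ⟨γ, ξ⟩ := ξ
  · simp only [List.map_nil, List.length_nil, List.length_map, List.length_eq_zero_iff] at hlen
    subst hlen
    exact ⟨[], h, rfl⟩
  · refine ⟨_, lift_eval_marker_iff.2 ⟨_, rfl, h⟩, ?_⟩
    obtain _ | ⟨m, ms⟩ := ms
    · simp at hlen
    have h0 : 0 < (m :: ms).foldl dyckCons 0 :=
      (dyckCons_pos 0 m).trans_le (le_foldl_dyckCons _ _)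
    rw [liftMeasure, if_neg h0.ne', ← foldl_map_liftMeasure]
    rfl

theorem Eval.to_lift {P : PDA T} {q p : P.State} {ξ : List P.StackSym} {w : List T}
    {ms : List ℕ} (h : P.Eval q ξ w p ms) :
    P.lift.Eval q (ξ.map .inl) w p (ms.map liftMeasure) := by
  induction h with
  | nil q => exact Eval.nil (P := P.lift) q
  | cons ha _ _ ih₁ ih₂ =>
    obtain ⟨ms', h, e⟩ := liftMeasure_foldl ih₁
    rw [List.map_cons, List.map_cons, ← e]
    exact .cons (lift_action_inl_iff.2 ⟨_, rfl, ha⟩) h ih₂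

theorem Eval.of_lift {P : PDA T} {q p : P.lift.State} {ξ' : List P.lift.StackSym} {w : List T}
    {ms' : List ℕ} (h : P.lift.Eval q ξ' w p ms') :
    (∀ ξ, ξ' = ξ.map .inl → ∃ ms, ms' = ms.map liftMeasure ∧ P.Eval q ξ w p ms) ∧
      ∀ ξ, ξ' = .inr 0 :: ξ.map .inl →
        ∃ ms, ms' = 1 :: ms.map liftMeasure ∧ P.Eval q ξ w p ms := by
  induction h with
  | nil q =>
    refine ⟨fun ξ hξ => ?_, by simp⟩
    obtain rfl := List.map_eq_nil_iff.1 hξ.symm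
    exact ⟨[], rfl, Eval.nil (P := P) q⟩
  | @cons q p₁ p₂ p b γ₀ ξ₀ ξ₂ w₁ w₂ ms₀ ms' ha h₁ h₂ ih₁ ih₂ =>
    constructor
    · intro ξ hξ
      obtain ⟨γ, ξ, rfl, rfl, rfl⟩ := List.map_eq_cons_iff.1 hξ.symm
      obtain ⟨ξ₁, rfl, ha'⟩ := lift_action_inl_iff.1 ha
      obtain ⟨ms₂, rfl, e₂⟩ := ih₂.1 ξ rfl
      obtain ⟨ms₁, e₁, e⟩ : ∃ ms₁, P.Eval p₁ ξ₁ w₁ p₂ ms₁ ∧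
          ms₀.foldl dyckCons 0 = liftMeasure (ms₁.foldl dyckCons 0) := by
        obtain _ | ⟨γ₁, ξ₁⟩ := ξ₁
        · obtain ⟨ms₁, rfl, e₁⟩ := ih₁.1 [] rfl
          obtain ⟨rfl, rfl, rfl⟩ := e₁.nil_inv
          exact ⟨[], e₁, rfl⟩
        · obtain ⟨ms₁, rfl, e₁⟩ := ih₁.2 (γ₁ :: ξ₁) rfl
          refine ⟨ms₁, e₁, ?_⟩
          exact (foldl_map_liftMeasure ms₁ 0).trans (if_neg (by
            obtain _ | ⟨m, ms₁⟩ := ms₁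
            · simpa using e₁.length_eq
            · exact ((dyckCons_pos 0 m).trans_le (le_foldl_dyckCons _ _)).ne')).symm
      exact ⟨_, by rw [List.map_cons, e], .cons ha' e₁ e₂⟩
    · intro ξ hξ
      obtain ⟨rfl, rfl⟩ := List.cons_eq_cons.1 hξ
      obtain ⟨rfl, rfl, rfl⟩ := lift_action_zero_iff.1 ha
      cases h₁ with
      | cons ha' h₃ h₄ =>
        obtain ⟨rfl, rfl, rfl⟩ := lift_action_one_iff.1 ha'
        obtain ⟨rfl, rfl, rfl⟩ := h₃.nil_inv
        obtain ⟨rfl, rfl, rfl⟩ := h₄.nil_inv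
        obtain ⟨ms₂, rfl, e₂⟩ := ih₂.1 ξ rfl
        exact ⟨ms₂, rfl, e₂⟩

theorem oscLanguage_lift (P : PDA T) (k : ℕ) :
    P.lift.oscLanguage (k + 1) = P.oscLanguage k := by
  ext w
  rw [mem_oscLanguage_iff, mem_oscLanguage_iff]
  -- Joining with `1` does not change a measure that is at least `2`, so the outer pair of the
  -- footprint preserves the shift by two.
  have key : ∀ x, dyckCons 0 ([1, liftMeasure x].foldl dyckCons 0) = dyckCons 0 x + 2 := by
    intro x
    have h : ([1, liftMeasure x].foldl dyckCons 0) = dyckCons 0 x + 2 := dyckCons_liftMeasure 0 x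
    rw [h]
    generalize dyckCons 0 x = y
    unfold dyckCons dyckJoin; split_ifs <;> omega
  constructor
  · rintro ⟨p, x, h, hk⟩
    obtain ⟨b, p₁, ξ, w₁, ms, ha, h₁, rfl, rfl⟩ := eval_singleton_iff.1 h
    obtain ⟨-, rfl, rfl, rfl⟩ := lift_action_two_iff.1 ha
    obtain ⟨ms, rfl, e⟩ := h₁.of_lift.2 [P.startSym] rfl
    obtain ⟨x, rfl⟩ := List.length_eq_one_iff.1 (e.length_eq.trans (by rfl))
    have := key x
    refine ⟨p, x, e, ?_⟩
    rw [List.map_cons, List.map_nil, this] at hk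
    omega
  · rintro ⟨p, x, h, hk⟩
    refine ⟨p, _, eval_singleton_iff.2 ⟨none, _, _, _, _,
      lift_action_two_iff.2 ⟨rfl, rfl, rfl, rfl⟩,
      lift_eval_marker_iff.2 ⟨_, rfl, h.to_lift⟩, rfl, rfl⟩, ?_⟩
    have := key x
    rw [List.map_cons, List.map_nil, this]
    omega

end PDA

theorem IsOscillating.sup {T : Type} {k : ℕ} {L₁ L₂ : Language T} (h₁ : IsOscillating k L₁)
    (h₂ : IsOscillating k L₂) : IsOscillating k (L₁ ⊔ L₂) := by
  obtain ⟨P₁, rfl⟩ := h₁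
  obtain ⟨P₂, rfl⟩ := h₂
  exact ⟨P₁.union P₂, (P₁.oscLanguage_union P₂ k).symm⟩

theorem IsOscillating.mono {T : Type} {k l : ℕ} {L : Language T} (h : IsOscillating k L)
    (hkl : k ≤ l) : IsOscillating l L := by
  induction hkl with
  | refl => exact h
  | step _ ih =>
    obtain ⟨P, rfl⟩ := ih
    exact ⟨P.lift, (P.oscLanguage_lift _).symm⟩

theorem IsBoundedOscillation.sup {T : Type} {L₁ L₂ : Language T}
    (h₁ : IsBoundedOscillation L₁) (h₂ : IsBoundedOscillation L₂) :
    IsBoundedOscillation (L₁ ⊔ L₂) := by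
  obtain ⟨k₁, h₁⟩ := h₁
  obtain ⟨k₂, h₂⟩ := h₂
  exact ⟨max k₁ k₂, (h₁.mono (le_max_left _ _)).sup (h₂.mono (le_max_right _ _))⟩

/-! ### Linear grammars -/

/-- Derivations of the linear grammar with the rules `A → o B o'`, for `(A, o, B, o') ∈ R`, and
`A → ε`, for `A ∈ E`. -/
inductive LinearDerives {T N : Type} (R : Set (N × Option T × N × Option T)) (E : Set N) :
    N → List T → Prop
  | erase {A : N} (h : A ∈ E) : LinearDerives R E A []
  | step {A B : N} {o o' : Option T} {w : List T} (h : (A, o, B, o') ∈ R)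
      (hw : LinearDerives R E B w) : LinearDerives R E A (o.toList ++ (w ++ o'.toList))

/-- The language that the linear grammar derives from `A`. -/
def linearLanguage {T N : Type} (R : Set (N × Option T × N × Option T)) (E : Set N) (A : N) :
    Language T :=
  {w | LinearDerives R E A w}

/-- The automaton of a linear grammar with initial symbol `S`. -/
abbrev linearPDA {T N : Type} [Finite T] [Finite N] (R : Set (N × Option T × N × Option T))
    (E : Set N) (S : N) : PDA T where
  State := Unit
  StackSym := Option (N ⊕ T)
  finite_state := inferInstance
  finite_stackSym := inferInstance
  actions :=
    ({((), none, none, (), [some (.inl S)])} ∪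
      (fun r => ((), r.2.1, some (.inl r.1), (),
        some (.inl r.2.2.1) :: r.2.2.2.toList.map fun t => some (.inr t))) '' R) ∪
    ((fun A => ((), none, some (.inl A), (), [])) '' E ∪
      Set.range fun t => ((), some t, some (.inr t), (), []))
  finite_actions :=
    ((Set.finite_singleton _).union ((Set.toFinite R).image _)).union
      (((Set.toFinite E).image _).union (Set.finite_range _))
  start := ()
  startSym := none

section Linear

variable {T N : Type} [Finite T] [Finite N] (R : Set (N × Option T × N × Option T)) (E : Set N)
  (S : N)

/-- The language of a stack symbol of `linearPDA`. -/
def linearDen : Option (N ⊕ T) → Language T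
  | none => linearLanguage R E S
  | some (.inl A) => linearLanguage R E A
  | some (.inr t) => {[t]}

theorem linearPDA_sound {q p : (linearPDA R E S).State} {ξ : List (linearPDA R E S).StackSym}
    {w : List T} {ms : List ℕ} (h : (linearPDA R E S).Eval q ξ w p ms) :
    w ∈ (ξ.map (linearDen R E S)).prod := by
  induction h with
  | nil => exact rfl
  | @cons q p₁ p₂ p b γ ξ' ξ w₁ w₂ ms' ms ha _ _ ih₁ ih₂ =>
    rw [List.map_cons, List.prod_cons, ← List.append_assoc]
    refine Language.append_mem_mul ?_ ih₂
    obtain ((h | ⟨⟨A, o, B, o'⟩, hr, h⟩) | (⟨A, hA, h⟩ | ⟨t, h⟩)) := ha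
    · obtain ⟨-, rfl, rfl, -, rfl⟩ := by simpa only [Prod.mk.injEq] using h
      rwa [List.map_singleton, List.prod_singleton] at ih₁
    · obtain ⟨-, rfl, rfl, -, rfl⟩ := by simpa only [Prod.mk.injEq] using h
      rw [List.map_cons, List.prod_cons] at ih₁
      obtain ⟨u, hu, v, hv, rfl⟩ := Language.mem_mul.1 ih₁
      have : v = o'.toList := by
        cases o' with
        | none => exact hv
        | some t =>
          rw [Option.toList_some, List.map_singleton, List.map_singleton, List.prod_singleton] at hv
          exact hv
      subst this
      exact LinearDerives.step hr hu
    · obtain ⟨-, rfl, rfl, -, rfl⟩ := by simpa only [Prod.mk.injEq] using h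
      obtain rfl : w₁ = [] := ih₁
      exact LinearDerives.erase hA
    · obtain ⟨-, rfl, rfl, -, rfl⟩ := by simpa only [Prod.mk.injEq] using h
      obtain rfl : w₁ = [] := ih₁
      exact rfl

/-- Only one pushed symbol carries a long computation; the other is popped at once with measure `0`.
The bound `3` is preserved by `x ↦ dyckCons (dyckCons 0 x) 0` and by `dyckCons 0`. -/
theorem linearPDA_complete {A : N} {w : List T} (h : LinearDerives R E A w) :
    ∃ x ≤ 3, (linearPDA R E S).Eval () [some (.inl A)] w () [x] := by
  induction h with
  | erase h =>
    exact ⟨0, by omega, PDA.eval_singleton_iff.2 ⟨none, (), [], [], [],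
      .inr (.inl ⟨_, h, rfl⟩), .nil _, rfl, rfl⟩⟩
  | @step A B o o' w h hw ih =>
    obtain ⟨x, hx, e⟩ := ih
    have ha : ((), o, some (.inl A), (), some (.inl B) :: o'.toList.map fun t => some (.inr t)) ∈
      (linearPDA R E S).actions := .inl (.inr ⟨_, h, rfl⟩)
    cases o' with
    | none =>
      refine ⟨_, ?_, PDA.eval_singleton_iff.2 ⟨o, (), _, w, [x], ha, e, by simp, rfl⟩⟩
      simp only [List.foldl_cons, List.foldl_nil]
      unfold dyckCons dyckJoin; split_ifs <;> omega
    | some t =>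
      have e' : (linearPDA R E S).Eval () [some (.inr t)] [t] () [0] :=
        PDA.eval_singleton_iff.2 ⟨some t, (), [], [], [], .inr (.inr ⟨t, rfl⟩), .nil _, rfl, rfl⟩
      refine ⟨_, ?_, PDA.eval_singleton_iff.2 ⟨o, (), _, _, _, ha, e.append e', rfl, rfl⟩⟩
      interval_cases x <;> decide

theorem isOscillating_one_linear : IsOscillating 1 (linearLanguage R E S) := by
  refine ⟨linearPDA R E S, ?_⟩
  ext w
  rw [PDA.mem_oscLanguage_iff]
  constructor
  · intro h
    obtain ⟨x, hx, e⟩ := linearPDA_complete R E S h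
    -- The additional initial move makes the rank exactly `1`: without it, erasing `S` at once would
    -- give rank `0`.
    refine ⟨(), _, PDA.eval_singleton_iff.2 ⟨none, (), _, w, [x], .inl (.inl rfl), e, rfl, rfl⟩, ?_⟩
    interval_cases x <;> decide
  · rintro ⟨p, x, h, -⟩
    have := linearPDA_sound R E S h
    rwa [List.map_singleton, List.prod_singleton] at this

end Linear

theorem LinearDerives.step_eq {T N : Type} {R : Set (N × Option T × N × Option T)} {E : Set N}
    {A B : N} (o o' : Option T) {w w' : List T} (h : (A, o, B, o') ∈ R)
    (hw : LinearDerives R E B w) (e : w' = o.toList ++ (w ++ o'.toList)) :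
    LinearDerives R E A w' :=
  e ▸ .step h hw

/-! ### Two linear languages over three letters. -/

theorem isOscillating_one_langAnBnCj : IsOscillating 1 langAnBnCj := by
  have e := isOscillating_one_linear (N := Bool)
    {(false, none, false, some (2 : Fin 3)), (false, none, true, none),
      (true, some 0, true, some 1)} {true} false
  convert e using 1
  ext w
  constructor
  · rintro ⟨n, j, rfl⟩
    have h : LinearDerives (N := Bool)
        {(false, none, false, some (2 : Fin 3)), (false, none, true, none),
          (true, some 0, true, some 1)} {true} true (.replicate n 0 ++ .replicate n 1) := by
      induction n with
      | zero => exact .erase rfl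
      | succ n ih =>
        refine .step_eq (some 0) (some 1) (by simp) ih ?_
        rw [List.replicate_succ, List.replicate_succ']
        simp
    show LinearDerives _ _ _ _
    induction j with
    | zero => exact .step_eq none none (by simp) h (by simp)
    | succ j ih =>
      refine .step_eq none (some 2) (by simp) ih ?_
      rw [List.replicate_succ' (n := j)]
      simp
  · intro h
    have key : ∀ (A : Bool) (w : List (Fin 3)), LinearDerives (N := Bool)
        {(false, none, false, some (2 : Fin 3)), (false, none, true, none),
          (true, some 0, true, some 1)} {true} A w →
        ∃ n j : ℕ, (A = true → j = 0) ∧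
          w = .replicate n 0 ++ .replicate n 1 ++ .replicate j 2 := by
      intro A w h
      induction h with
      | erase h => exact ⟨0, 0, fun _ => rfl, rfl⟩
      | step h _ ih =>
        obtain ⟨n, j, hj, rfl⟩ := ih
        simp only [Set.mem_insert_iff, Set.mem_singleton_iff, Prod.mk.injEq] at h
        obtain ⟨rfl, rfl, rfl, rfl⟩ | ⟨rfl, rfl, rfl, rfl⟩ | ⟨rfl, rfl, rfl, rfl⟩ := h
        · refine ⟨n, j + 1, by simp, ?_⟩
          rw [List.replicate_succ' (n := j)]
          simp
        · exact ⟨n, j, by simp, by simp⟩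
        · obtain rfl := hj rfl
          refine ⟨n + 1, 0, by simp, ?_⟩
          rw [List.replicate_succ, List.replicate_succ' (n := n)]
          simp
    obtain ⟨n, j, -, e⟩ := key _ _ h
    exact ⟨n, j, e⟩

theorem isOscillating_one_langAjBnCn : IsOscillating 1 langAjBnCn := by
  have e := isOscillating_one_linear (N := Bool)
    {(false, some (0 : Fin 3), false, none), (false, none, true, none),
      (true, some 1, true, some 2)} {true} false
  convert e using 1
  ext w
  constructor
  · rintro ⟨n, j, rfl⟩
    have h : LinearDerives (N := Bool)
        {(false, some (0 : Fin 3), false, none), (false, none, true, none),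
          (true, some 1, true, some 2)} {true} true (.replicate n 1 ++ .replicate n 2) := by
      induction n with
      | zero => exact .erase rfl
      | succ n ih =>
        refine .step_eq (some 1) (some 2) (by simp) ih ?_
        rw [List.replicate_succ, List.replicate_succ']
        simp
    show LinearDerives _ _ _ _
    induction j with
    | zero => exact .step_eq none none (by simp) h (by simp)
    | succ j ih =>
      refine .step_eq (some 0) none (by simp) ih ?_
      rw [List.replicate_succ (n := j)]
      simp
  · intro h
    have key : ∀ (A : Bool) (w : List (Fin 3)), LinearDerives (N := Bool)
        {(false, some (0 : Fin 3), false, none), (false, none, true, none),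
          (true, some 1, true, some 2)} {true} A w →
        ∃ n j : ℕ, (A = true → j = 0) ∧
          w = .replicate j 0 ++ .replicate n 1 ++ .replicate n 2 := by
      intro A w h
      induction h with
      | erase h => exact ⟨0, 0, fun _ => rfl, rfl⟩
      | step h _ ih =>
        obtain ⟨n, j, hj, rfl⟩ := ih
        simp only [Set.mem_insert_iff, Set.mem_singleton_iff, Prod.mk.injEq] at h
        obtain ⟨rfl, rfl, rfl, rfl⟩ | ⟨rfl, rfl, rfl, rfl⟩ | ⟨rfl, rfl, rfl, rfl⟩ := h
        · refine ⟨n, j + 1, by simp, ?_⟩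
          rw [List.replicate_succ (n := j)]
          simp
        · exact ⟨n, j, by simp, by simp⟩
        · obtain rfl := hj rfl
          refine ⟨n + 1, 0, by simp, ?_⟩
          rw [List.replicate_succ, List.replicate_succ' (n := n)]
          simp
    obtain ⟨n, j, -, e⟩ := key _ _ h
    exact ⟨n, j, e⟩

/-! ### The languages of the two context-free grammars -/

/-- The language of a symbol under an assignment of languages to the nonterminals. -/
def symbolDen {T N : Type} (den : N → Language T) : Symbol T N → Language T
  | .terminal t => {[t]}
  | .nonterminal A => den A

/-- Along a derivation the product of the assigned languages can only shrink, and a terminal word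
belongs to its own product. -/
theorem ContextFreeGrammar.language_le_of_rules {T : Type} (g : ContextFreeGrammar T)
    (den : g.NT → Language T)
    (h : ∀ r ∈ g.rules, (r.output.map (symbolDen den)).prod ≤ den r.input) :
    g.language ≤ den g.initial := by
  have key : ∀ u v : List (Symbol T g.NT), g.Derives u v →
      (v.map (symbolDen den)).prod ≤ (u.map (symbolDen den)).prod := by
    intro u v huv
    induction huv with
    | refl => exact le_rfl
    | tail _ hs ih =>
      refine le_trans ?_ ih
      obtain ⟨r, hr, hrw⟩ := hs
      obtain ⟨p, q, rfl, rfl⟩ := hrw.exists_parts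
      simp only [List.map_append, List.prod_append, List.map_cons, List.map_nil, List.prod_cons,
        List.prod_nil, mul_one]
      gcongr
      exact h r hr
  intro w hw
  have h1 := key _ _ hw
  have h2 : ∀ w : List T, w ∈ ((w.map Symbol.terminal).map (symbolDen den)).prod := by
    intro w
    induction w with
    | nil => exact rfl
    | cons t w ih =>
      rw [List.map_cons, List.map_cons, List.prod_cons]
      exact Language.append_mem_mul (a := [t]) rfl ih
  simpa [symbolDen] using h1 (h2 w)

theorem mem_evenPalindromeGrammar_rules (r : ContextFreeRule Bool Unit) :
    r ∈ evenPalindromeGrammar.rules ↔ r = ⟨(), [.terminal false, .nonterminal (), .terminal false]⟩ ∨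
      r = ⟨(), [.terminal true, .nonterminal (), .terminal true]⟩ ∨ r = ⟨(), []⟩ :=
  Finset.mem_insert.trans (or_congr Iff.rfl (Finset.mem_insert.trans
    (or_congr Iff.rfl Finset.mem_singleton)))

theorem mem_dyckGrammar_rules (r : ContextFreeRule DyckStep Unit) :
    r ∈ dyckGrammar.rules ↔
      r = ⟨(), [.terminal .U, .nonterminal (), .terminal .D, .nonterminal ()]⟩ ∨ r = ⟨(), []⟩ :=
  Finset.mem_insert.trans (or_congr Iff.rfl Finset.mem_singleton)

theorem mem_evenPalindromes_iff {w : List Bool} :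
    w ∈ evenPalindromes ↔ ∃ u : List Bool, w = u ++ u.reverse := by
  constructor
  · refine fun h => evenPalindromeGrammar.language_le_of_rules
      (fun _ => ({w | ∃ u : List Bool, w = u ++ u.reverse} : Set (List Bool))) ?_ h
    intro r hr
    have key : ∀ b : Bool, (([.terminal b, .nonterminal (), .terminal b] :
        List (Symbol Bool Unit)).map (symbolDen fun _ =>
          ({w | ∃ u : List Bool, w = u ++ u.reverse} : Set (List Bool)))).prod ≤
        ({w | ∃ u : List Bool, w = u ++ u.reverse} : Set (List Bool)) := by
      intro b w hw
      rw [List.map_cons, List.prod_cons, List.map_cons, List.prod_cons, List.map_singleton,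
        List.prod_singleton] at hw
      obtain ⟨x, rfl, y, hy, rfl⟩ := Language.mem_mul.1 hw
      obtain ⟨y, ⟨u, rfl⟩, z, rfl, rfl⟩ := Language.mem_mul.1 hy
      exact ⟨b :: u, by simp⟩
    obtain rfl | rfl | rfl := (mem_evenPalindromeGrammar_rules r).1 hr
    · exact key false
    · exact key true
    · rintro w rfl
      exact ⟨[], rfl⟩
  · rintro ⟨u, rfl⟩
    have step : ∀ b : Bool, evenPalindromeGrammar.Produces [.nonterminal ()]
        [.terminal b, .nonterminal (), .terminal b] := by
      intro b
      refine ⟨⟨(), [.terminal b, .nonterminal (), .terminal b]⟩, ?_,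
        ContextFreeRule.Rewrites.input_output⟩
      cases b
      · exact (mem_evenPalindromeGrammar_rules _).2 (.inl rfl)
      · exact (mem_evenPalindromeGrammar_rules _).2 (.inr (.inl rfl))
    have key : evenPalindromeGrammar.Derives [.nonterminal ()]
        ((u ++ u.reverse).map .terminal) := by
      induction u with
      | nil =>
        exact ContextFreeGrammar.Produces.single ⟨⟨(), []⟩,
          (mem_evenPalindromeGrammar_rules _).2 (.inr (.inr rfl)),
          ContextFreeRule.Rewrites.input_output⟩
      | cons b u ih =>
        have h := (step b).trans_derives ((ih.append_left [.terminal b]).append_right [.terminal b])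
        simpa using h
    exact key

theorem isOscillating_one_evenPalindromes : IsOscillating 1 evenPalindromes := by
  have e := isOscillating_one_linear (N := Unit)
    (Set.range fun b : Bool => ((), some b, (), some b)) Set.univ ()
  convert e using 1
  ext w
  rw [mem_evenPalindromes_iff]
  constructor
  · rintro ⟨u, rfl⟩
    show LinearDerives _ _ _ _
    induction u with
    | nil => exact .erase trivial
    | cons b u ih => exact .step_eq (some b) (some b) ⟨b, rfl⟩ ih (by simp)
  · intro (h : LinearDerives _ _ _ _)
    generalize () = A at h
    induction h with
    | erase h => exact ⟨[], rfl⟩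
    | step h _ ih =>
      obtain ⟨u, rfl⟩ := ih
      obtain ⟨b, h⟩ := h
      simp only [Prod.mk.injEq] at h
      obtain ⟨-, rfl, -, rfl⟩ := h
      exact ⟨b :: u, by simp⟩

theorem mem_dyckLanguage_iff {w : List DyckStep} :
    w ∈ dyckLanguage ↔ ∃ a, DyckMeasure w a := by
  constructor
  · refine fun h => dyckGrammar.language_le_of_rules
      (fun _ => ({w | ∃ a, DyckMeasure w a} : Set (List DyckStep))) ?_ h
    intro r hr w hw
    obtain rfl | rfl := (mem_dyckGrammar_rules r).1 hr
    · change w ∈ (([.terminal .U, .nonterminal (), .terminal .D, .nonterminal ()] :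
        List (Symbol DyckStep Unit)).map (symbolDen fun _ =>
          ({w | ∃ a, DyckMeasure w a} : Set (List DyckStep)))).prod at hw
      rw [List.map_cons, List.prod_cons, List.map_cons, List.prod_cons, List.map_cons,
        List.prod_cons, List.map_singleton, List.prod_singleton] at hw
      obtain ⟨x, rfl, y, hy, rfl⟩ := Language.mem_mul.1 hw
      obtain ⟨u, ⟨a, hu⟩, z, hz, rfl⟩ := Language.mem_mul.1 hy
      obtain ⟨x, rfl, v, ⟨b, hv⟩, rfl⟩ := Language.mem_mul.1 hz
      exact ⟨_, .node hu hv⟩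
    · obtain rfl := hw
      exact ⟨0, .nil⟩
  · rintro ⟨a, h⟩
    have key : dyckGrammar.Derives [.nonterminal ()] (w.map .terminal) := by
      induction h with
      | nil =>
        exact ContextFreeGrammar.Produces.single ⟨⟨(), []⟩, (mem_dyckGrammar_rules _).2 (.inr rfl),
          ContextFreeRule.Rewrites.input_output⟩
      | @node u v a b _ _ ihu ihv =>
        have h0 : dyckGrammar.Produces [.nonterminal ()]
            [.terminal .U, .nonterminal (), .terminal .D, .nonterminal ()] :=
          ⟨⟨(), [.terminal .U, .nonterminal (), .terminal .D, .nonterminal ()]⟩,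
            (mem_dyckGrammar_rules _).2 (.inl rfl), ContextFreeRule.Rewrites.input_output⟩
        have h1 := (ihu.append_left [.terminal .U]).append_right
          [.terminal .D, .nonterminal ()]
        have h2 := ihv.append_left ([.terminal .U] ++ u.map .terminal ++ [.terminal .D])
        have h3 := (h0.trans_derives h1).trans (by simpa using h2)
        simpa using h3
    exact key

/-! ### Deterministic automata -/

namespace PDA

open Relation

variable {T : Type} {P : PDA T}

theorem Move.append_tape {I J : P.ID} (h : P.Move I J) (z : List T) :
    P.Move ⟨I.state, I.tape ++ z, I.stack⟩ ⟨J.state, J.tape ++ z, J.stack⟩ := by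
  cases h with
  | mk h w ξ => simpa using Move.mk h (w ++ z) ξ

theorem reach_append_tape {I J : P.ID} (h : ReflTransGen P.Move I J) (z : List T) :
    ReflTransGen P.Move ⟨I.state, I.tape ++ z, I.stack⟩ ⟨J.state, J.tape ++ z, J.stack⟩ := by
  induction h with
  | refl => exact .refl
  | tail _ h ih => exact ih.tail (h.append_tape z)

theorem reach_strip_tape {I J : P.ID} (h : ReflTransGen P.Move I J) :
    ∃ c, I.tape = c ++ J.tape ∧
      ReflTransGen P.Move ⟨I.state, c, I.stack⟩ ⟨J.state, [], J.stack⟩ := by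
  induction h using ReflTransGen.head_induction_on with
  | refl => exact ⟨[], rfl, .refl⟩
  | head h _ ih =>
    obtain ⟨c, hc, hr⟩ := ih
    cases h with
    | @mk q p b γ ξ' ha w ξ =>
      exact ⟨b.toList ++ c, by simpa using hc, .head (Move.mk ha c ξ) hr⟩

theorem IsDeterministic.move_unique (hP : P.IsDeterministic) {I J K : P.ID} (h : P.Move I J)
    (h' : P.Move I K) : J = K := by
  obtain ⟨q, t, s⟩ := I
  generalize hI : (⟨q, t, s⟩ : P.ID) = I at h h'
  cases h with
  | @mk q p b γ ξ' ha w ξ =>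
    generalize hI' : (⟨q, b.toList ++ w, γ :: ξ⟩ : P.ID) = I' at h'
    cases h' with
    | @mk q' p' b' γ' ξ₁ ha' w' ζ =>
      simp only [ID.mk.injEq, List.cons.injEq] at hI'
      obtain ⟨rfl, hw, rfl, rfl⟩ := hI'
      cases b with
      | none =>
        cases b' with
        | none =>
          obtain ⟨rfl, rfl⟩ := hP.unique _ _ _ _ _ _ _ ha ha'
          obtain rfl : w = w' := hw
          rfl
        | some t' => exact absurd ha' (hP.no_choice _ _ _ _ _ _ _ ha)
      | some t =>
        cases b' with
        | none => exact absurd ha (hP.no_choice _ _ _ _ _ _ _ ha')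
        | some t' =>
          obtain ⟨rfl, rfl⟩ : t = t' ∧ w = w' := by simpa using hw
          obtain ⟨rfl, rfl⟩ := hP.unique _ _ _ _ _ _ _ ha ha'
          rfl

/-- A deterministic computation that accepts `r z` with `z ≠ ε` passes through every descriptor
reached after reading `r`. -/
theorem IsDeterministic.reach_final (hP : P.IsDeterministic) {q f : P.State}
    {ξ η : List P.StackSym} {r z : List T} (hz : z ≠ [])
    (hr : ReflTransGen P.Move (P.initial r) ⟨q, [], ξ⟩)
    (hf : ReflTransGen P.Move (P.initial (r ++ z)) ⟨f, [], η⟩) :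
    ReflTransGen P.Move ⟨q, z, ξ⟩ ⟨f, [], η⟩ := by
  have h1 : ReflTransGen P.Move (P.initial (r ++ z)) ⟨q, z, ξ⟩ := reach_append_tape hr z
  have hu : Relator.RightUnique P.Move := fun _ _ _ h h' => hP.move_unique h h'
  obtain h | h := ReflTransGen.total_of_right_unique hu h1 hf
  · exact h
  · obtain ⟨c, hc, -⟩ := reach_strip_tape h
    simp only [List.nil_eq, List.append_eq_nil_iff] at hc
    exact absurd hc.2 hz

/-- As long as the stack stays higher than `ξ`, no move touches `ξ`, so any `ζ` may take its place.
-/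
theorem reach_strip_stack {q : P.State} {γ : P.StackSym} {ξ : List P.StackSym} {z : List T}
    (hmin : ∀ J, ReflTransGen P.Move ⟨q, z, γ :: ξ⟩ J → ξ.length < J.stack.length) {J : P.ID}
    (h : ReflTransGen P.Move ⟨q, z, γ :: ξ⟩ J) :
    ∃ η, J.stack = η ++ ξ ∧
      ∀ ζ, ReflTransGen P.Move ⟨q, z, γ :: ζ⟩ ⟨J.state, J.tape, η ++ ζ⟩ := by
  induction h with
  | refl => exact ⟨[γ], rfl, fun ζ => .refl⟩
  | tail hK h ih =>
    obtain ⟨η, hη, hr⟩ := ih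
    have hlt := hmin _ hK
    cases h with
    | @mk p p' b γ' ξ' ha w κ =>
      obtain _ | ⟨γ₁, η⟩ := η
      · simp only at hη hlt
        simp [hη] at hlt
      · simp only [List.cons_append, List.cons.injEq] at hη
        obtain ⟨rfl, rfl⟩ := hη
        refine ⟨ξ' ++ η, by simp, fun ζ => (hr ζ).tail ?_⟩
        simpa using Move.mk ha w (η ++ ζ)

/-- For every word `x` there is an extension `r` after which the automaton never again descends
below the current top of its stack. -/
theorem IsDeterministic.exists_minimal (hP : P.IsDeterministic) {F : Set P.State}
    (hL : ∀ x : List T, ∃ z, z ≠ [] ∧ x ++ z ∈ P.finalLanguage F) (x : List T) :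
    ∃ (r : List T) (q : P.State) (γ : P.StackSym) (ξ : List P.StackSym),
      x.length ≤ r.length ∧ ReflTransGen P.Move (P.initial r) ⟨q, [], γ :: ξ⟩ ∧
      ∀ z J, ReflTransGen P.Move ⟨q, z, γ :: ξ⟩ J → ξ.length < J.stack.length := by
  classical
  -- The extension of `x` and the descriptor are chosen with the least stack height over all
  -- extensions; anything reached later competes in the same minimum.
  have hex : ∃ n, ∃ y q ξ, ReflTransGen P.Move (P.initial (x ++ y)) ⟨q, [], ξ⟩ ∧
      ξ.length = n := by
    obtain ⟨z, -, q, -, ξ, h⟩ := hL x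
    exact ⟨_, z, q, ξ, h, rfl⟩
  obtain ⟨y, q, ξ, h, hlen⟩ := Nat.find_spec hex
  have hmin : ∀ z J, ReflTransGen P.Move ⟨q, z, ξ⟩ J → ξ.length ≤ J.stack.length := by
    intro z J hJ
    obtain ⟨c, -, hc⟩ := reach_strip_tape hJ
    have h1 : ReflTransGen P.Move (P.initial (x ++ y ++ c)) ⟨q, c, ξ⟩ := reach_append_tape h c
    rw [hlen]
    exact Nat.find_min' hex ⟨y ++ c, J.state, J.stack, by simpa using h1.trans hc, rfl⟩
  -- An empty stack would block the automaton, although the word read so far is a proper prefix of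
  -- an accepted word.
  obtain _ | ⟨γ, ξ⟩ := ξ
  · obtain ⟨z, hz, f, -, η, hf⟩ := hL (x ++ y)
    have h1 := hP.reach_final hz h hf
    obtain h2 | ⟨J, h2, -⟩ := ReflTransGen.cases_head h1
    · simp only [ID.mk.injEq] at h2
      exact absurd h2.2.1 hz
    · cases h2
  · exact ⟨x ++ y, q, γ, ξ, by simp, h, fun z J hJ => hmin z J hJ⟩

end PDA

/-- A language of which every word is a proper prefix and that separates any two words by a
nonempty word is not deterministic context-free. -/
theorem not_isDCFL_of_separating {T : Type} [Nonempty T] {L : Language T}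
    (hL : ∀ x : List T, ∃ z, z ≠ [] ∧ x ++ z ∈ L)
    (hsep : ∀ r s : List T, r.length < s.length → ∃ z, z ≠ [] ∧ r ++ z ∈ L ∧ s ++ z ∉ L) :
    ¬ IsDCFL L := by
  rintro ⟨P, F, hP, rfl⟩
  obtain ⟨t⟩ := ‹Nonempty T›
  have := P.finite_state
  have := P.finite_stackSym
  choose r q γ ξ hlen hreach hmin using
    fun n : ℕ => hP.exists_minimal hL (List.replicate n t)
  -- An infinite fibre is needed, not just a collision: `m` must exceed the length of `r n` so that
  -- `r m` is strictly longer.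
  obtain ⟨⟨p, δ⟩, hinf⟩ := Finite.exists_infinite_fiber fun n => (q n, γ n)
  have hinf := Set.infinite_coe_iff.1 hinf
  obtain ⟨n, hn⟩ := hinf.nonempty
  obtain ⟨m, hm, hlt⟩ := hinf.exists_gt (r n).length
  simp only [Set.mem_preimage, Set.mem_singleton_iff, Prod.mk.injEq] at hn hm
  have hlen := hlen m
  rw [List.length_replicate] at hlen
  obtain ⟨z, hz, ⟨f, hf, η, hη⟩, hs⟩ := hsep (r n) (r m) (hlt.trans_le hlen)
  have h1 := hP.reach_final hz (hreach n) hη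
  obtain ⟨η', -, hη'⟩ := PDA.reach_strip_stack (hmin n z) h1
  have h2 := hη' (ξ m)
  rw [hn.1, hn.2, ← hm.1, ← hm.2] at h2
  have h3 : Relation.ReflTransGen P.Move (P.initial (r m ++ z)) ⟨q m, z, γ m :: ξ m⟩ :=
    PDA.reach_append_tape (hreach m) z
  exact hs ⟨f, hf, _, h3.trans h2⟩

theorem not_isDCFL_evenPalindromes : ¬ IsDCFL evenPalindromes := by
  refine not_isDCFL_of_separating (fun x => ?_) (fun r s hrs => ?_)
  · refine ⟨true :: true :: x.reverse, by simp, mem_evenPalindromes_iff.2 ⟨x ++ [true], by simp⟩⟩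
  · obtain ⟨s₁, c, s₂, rfl, hlen⟩ : ∃ s₁ c s₂, s = s₁ ++ c :: s₂ ∧ s₁.length = r.length := by
      refine ⟨s.take r.length, s[r.length], s.drop (r.length + 1), ?_, ?_⟩
      · simp
      · simp; omega
    -- The letter of `s` at position `r.length` is `c`, while a palindrome ending in this word would
    -- have `!c` there.
    refine ⟨(!c) :: (!c) :: r.reverse, by simp,
      mem_evenPalindromes_iff.2 ⟨r ++ [!c], by simp⟩, fun h => ?_⟩
    obtain ⟨u, hu⟩ := mem_evenPalindromes_iff.1 h
    have hrev : ((s₁ ++ c :: s₂) ++ (!c) :: (!c) :: r.reverse).reverse =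
        (s₁ ++ c :: s₂) ++ (!c) :: (!c) :: r.reverse := by
      rw [hu]; simp
    simp only [List.reverse_append, List.reverse_cons, List.reverse_reverse, List.append_assoc,
      List.cons_append, List.nil_append] at hrev
    have := (List.append_inj hrev hlen.symm).2
    simp at this

/-! ### The Dyck language is deterministic context-free. -/

/-- `DyckPath n w`: the word `w` leads from height `n` to height `0` without going below `0`. -/
inductive DyckPath : ℕ → List DyckStep → Prop
  | nil : DyckPath 0 []
  | up {n : ℕ} {w : List DyckStep} (h : DyckPath (n + 1) w) : DyckPath n (.U :: w)
  | down {n : ℕ} {w : List DyckStep} (h : DyckPath n w) : DyckPath (n + 1) (.D :: w)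

theorem DyckPath.length_eval {n : ℕ} {w : List DyckStep} (h : DyckPath n w) :
    (dyckEval w).length = n + 1 := by
  induction h with
  | nil => rfl
  | @up n w h ih =>
    rcases hw : dyckEval w with _ | ⟨a, _ | ⟨b, s⟩⟩
    · simp [hw] at ih
    · simp [hw] at ih
    · rw [dyckEval_U hw]
      simpa [hw] using ih
  | @down n w h ih =>
    rcases hw : dyckEval w with _ | ⟨a, s⟩
    · simp [hw] at ih
    · rw [dyckEval_D hw]
      simpa [hw] using ih

theorem DyckMeasure.dyckPath_append {w : List DyckStep} {a : ℕ} (h : DyckMeasure w a) :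
    ∀ (n : ℕ) (v : List DyckStep), DyckPath n v → DyckPath n (w ++ v) := by
  induction h with
  | nil => exact fun _ _ h => h
  | node _ _ ihu ihv =>
    intro n v h
    simpa using DyckPath.up (ihu _ _ (.down (ihv _ _ h)))

theorem mem_dyckLanguage_iff_dyckPath {w : List DyckStep} : w ∈ dyckLanguage ↔ DyckPath 0 w := by
  rw [mem_dyckLanguage_iff]
  constructor
  · rintro ⟨a, h⟩
    simpa using h.dyckPath_append 0 [] .nil
  · intro h
    obtain ⟨a, ha⟩ := List.length_eq_one_iff.1 h.length_eval
    exact ⟨a, dyckMeasure_of_eval ha⟩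

/-- A deterministic automaton for the Dyck language. At height `0` it is in state `false` with stack
`0`; at height `n + 1` it is in state `true` with stack `2ⁿ 1 0`. -/
abbrev dyckPDA : PDA DyckStep where
  State := Bool
  StackSym := Fin 3
  finite_state := inferInstance
  finite_stackSym := inferInstance
  actions := {(false, some .U, 0, true, [1, 0]), (true, some .U, 1, true, [2, 1]),
    (true, some .U, 2, true, [2, 2]), (true, some .D, 2, true, []), (true, some .D, 1, false, [])}
  finite_actions := Set.toFinite _
  start := false
  startSym := 0

/-- The descriptor of `dyckPDA` at height `n` with remaining input `w`. -/
def dyckPDAID : ℕ → List DyckStep → dyckPDA.ID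
  | 0, w => ⟨false, w, [0]⟩
  | n + 1, w => ⟨true, w, List.replicate n 2 ++ [1, 0]⟩

theorem dyckPDA_move_up (n : ℕ) (w : List DyckStep) :
    dyckPDA.Move (dyckPDAID n (.U :: w)) (dyckPDAID (n + 1) w) := by
  obtain _ | _ | n := n
  · exact PDA.Move.mk (P := dyckPDA) (b := some .U) (ξ' := [1, 0]) (by simp) w []
  · exact PDA.Move.mk (P := dyckPDA) (b := some .U) (ξ' := [2, 1]) (by simp) w [0]
  · exact PDA.Move.mk (P := dyckPDA) (q := true) (p := true) (γ := 2) (b := some .U)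
      (ξ' := [2, 2]) (by simp) w
      (List.replicate n 2 ++ [1, 0])

theorem dyckPDA_move_down (n : ℕ) (w : List DyckStep) :
    dyckPDA.Move (dyckPDAID (n + 1) (.D :: w)) (dyckPDAID n w) := by
  obtain _ | n := n
  · exact PDA.Move.mk (P := dyckPDA) (q := true) (p := false) (γ := 1) (b := some .D)
      (ξ' := []) (by simp) w [0]
  · exact PDA.Move.mk (P := dyckPDA) (q := true) (p := true) (γ := 2) (b := some .D)
      (ξ' := []) (by simp) w
      (List.replicate n 2 ++ [1, 0])

theorem dyckPDA_isDeterministic : dyckPDA.IsDeterministic where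
  unique := by
    intro q b γ p p' ξ ξ' h h'
    simp only [Set.mem_insert_iff, Set.mem_singleton_iff, Prod.mk.injEq] at h h'
    grind
  no_choice := by
    intro q b γ p p' ξ ξ' h
    simp at h

theorem dyckPDA_move_inv {n : ℕ} {w : List DyckStep} {J : dyckPDA.ID}
    (h : dyckPDA.Move (dyckPDAID n w) J) :
    ∃ (m : ℕ) (v : List DyckStep), J = dyckPDAID m v ∧ (DyckPath m v → DyckPath n w) := by
  obtain _ | ⟨_ | _, w⟩ := w
  · exfalso
    generalize hI : dyckPDAID n [] = I at h
    cases h with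
    | mk ha w ξ =>
      have ht : (dyckPDAID n []).tape = [] := by cases n <;> rfl
      rw [hI] at ht
      simp only [Set.mem_insert_iff, Set.mem_singleton_iff, Prod.mk.injEq] at ha
      simp only [List.append_eq_nil_iff, Option.toList_eq_nil_iff] at ht
      obtain ⟨rfl, -⟩ := ht
      simp at ha
  · exact ⟨n + 1, w, dyckPDA_isDeterministic.move_unique h (dyckPDA_move_up n w), .up⟩
  · obtain _ | n := n
    · exfalso
      generalize hI : dyckPDAID 0 (.D :: w) = I at h
      cases h with
      | mk ha w ξ =>
        simp only [dyckPDAID, PDA.ID.mk.injEq, List.cons.injEq] at hI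
        obtain ⟨rfl, ht, rfl, -⟩ := hI
        simp only [Set.mem_insert_iff, Set.mem_singleton_iff, Prod.mk.injEq] at ha
        simp at ha
        obtain ⟨rfl, -⟩ := ha
        simp at ht
    · exact ⟨n, w, dyckPDA_isDeterministic.move_unique h (dyckPDA_move_down n w), .down⟩

theorem isDCFL_dyckLanguage : IsDCFL dyckLanguage := by
  refine ⟨dyckPDA, {false}, dyckPDA_isDeterministic, ?_⟩
  ext w
  rw [mem_dyckLanguage_iff_dyckPath]
  constructor
  · intro h
    have key : ∀ (n : ℕ) (w : List DyckStep), DyckPath n w →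
        Relation.ReflTransGen dyckPDA.Move (dyckPDAID n w) (dyckPDAID 0 []) := by
      intro n w h
      induction h with
      | nil => exact .refl
      | up _ ih => exact .head (dyckPDA_move_up _ _) ih
      | down _ ih => exact .head (dyckPDA_move_down _ _) ih
    exact ⟨false, rfl, [0], key 0 w h⟩
  · rintro ⟨q, rfl, ξ, h⟩
    have key : ∀ I : dyckPDA.ID, Relation.ReflTransGen dyckPDA.Move I ⟨false, [], ξ⟩ →
        ∀ n w, I = dyckPDAID n w → DyckPath n w := by
      intro I h
      induction h using Relation.ReflTransGen.head_induction_on with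
      | refl =>
        intro n w e
        obtain _ | n := n
        · simp only [dyckPDAID, PDA.ID.mk.injEq] at e
          obtain ⟨-, rfl, -⟩ := e
          exact .nil
        · simp [dyckPDAID] at e
      | head hm _ ih =>
        rintro n w rfl
        obtain ⟨m, v, rfl, hp⟩ := dyckPDA_move_inv hm
        exact hp (ih m v rfl)
    exact key _ h 0 w rfl

/-! ### Factorization trees of languages of bounded oscillation -/

/-- The Strahler number of a binary tree in terms of those of its two subtrees. -/
def strahler (s t : ℕ) : ℕ := if s = t then s + 1 else max s t

/-- `FactorTree B s w`: the word `w` is the yield of a binary tree of Strahler number `s` in which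
every inner node may contribute one letter and all yields of subtrees satisfy `B`. -/
inductive FactorTree {T : Type} (B : List T → Prop) : ℕ → List T → Prop
  | nil (h : B []) : FactorTree B 0 []
  | node {s t : ℕ} {b : Option T} {u v : List T} (h : B (b.toList ++ (u ++ v)))
      (hu : FactorTree B s u) (hv : FactorTree B t v) :
      FactorTree B (strahler s t) (b.toList ++ (u ++ v))

theorem FactorTree.holds {T : Type} {B : List T → Prop} {s : ℕ} {w : List T}
    (h : FactorTree B s w) : B w := by
  cases h <;> assumption

/-- Descend into a child of length greater than `l` until the length is at most `2 * l + 1`. If both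
children have length at most `l`, the node itself already satisfies this bound. -/
theorem FactorTree.exists_infix {T : Type} {B : List T → Prop} {s : ℕ} {w : List T}
    (h : FactorTree B s w) (l : ℕ) :
    l < w.length → ∃ v, v <:+: w ∧ B v ∧ l < v.length ∧ v.length ≤ 2 * l + 1 := by
  induction h with
  | nil => simp
  | @node s t b u v hB _ _ ihu ihv =>
    intro hl
    by_cases hs : (b.toList ++ (u ++ v)).length ≤ 2 * l + 1
    · exact ⟨_, List.infix_rfl, hB, hl, hs⟩
    have hb : b.toList.length ≤ 1 := by cases b <;> simp
    simp only [List.length_append] at hs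
    by_cases hu : l < u.length
    · obtain ⟨x, hx, h⟩ := ihu hu
      exact ⟨x, hx.trans ⟨b.toList, v, by simp⟩, h⟩
    · obtain ⟨x, hx, h⟩ := ihv (by omega)
      exact ⟨x, hx.trans ⟨b.toList ++ u, [], by simp⟩, h⟩

namespace PDA

variable {T : Type}

/-- The stack words that occur in evaluation trees of runs. -/
def pushable (P : PDA T) : Set (List P.StackSym) :=
  {ξ | ξ <:+ [P.startSym] ∨ ∃ α ∈ P.actions, ξ <:+ α.2.2.2.2}

theorem finite_pushable (P : PDA T) : P.pushable.Finite := by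
  have hs : ∀ ζ : List P.StackSym, {ξ | ξ <:+ ζ}.Finite := fun ζ =>
    (List.finite_toSet ζ.tails).subset fun ξ hξ => (List.mem_tails ξ ζ).2 hξ
  have h : P.pushable = {ξ | ξ <:+ [P.startSym]} ∪ ⋃ α ∈ P.actions, {ξ | ξ <:+ α.2.2.2.2} := by
    ext ξ; simp [pushable]
  rw [h]
  exact (hs _).union (P.finite_actions.biUnion fun α _ => hs _)

/-- All words evaluated with the given data occur in `L` between `u` and `v`. -/
def Context (P : PDA T) (L : Language T) (q : P.State) (ξ : List P.StackSym) (p : P.State)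
    (ms : List ℕ) (u v : List T) : Prop :=
  ∀ w, P.Eval q ξ w p ms → u ++ w ++ v ∈ L

/-- A context serves all words evaluated with the same data, so one choice per datum suffices. There
are finitely many data, because the stack words are suffixes of pushed words and the measures are
bounded. -/
theorem exists_context_bound (P : PDA T) (L : Language T) (D : ℕ) :
    ∃ C : ℕ, ∀ q ξ p ms, ξ ∈ P.pushable → ms.length = ξ.length → (∀ x ∈ ms, x ≤ D) →
      (∃ u v, P.Context L q ξ p ms u v) →
      ∃ u v, u.length ≤ C ∧ v.length ≤ C ∧ P.Context L q ξ p ms u v := by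
  classical
  have := P.finite_state
  obtain ⟨n, hn⟩ := (P.finite_pushable.image List.length).bddAbove
  have hms : {ms : List ℕ | ms.length ≤ n ∧ ∀ x ∈ ms, x ≤ D}.Finite := by
    refine ((List.finite_length_le (Fin (D + 1)) n).image (List.map Fin.val)).subset ?_
    rintro ms ⟨h1, h2⟩
    refine ⟨ms.map (Fin.ofNat (D + 1)), by simpa using h1, ?_⟩
    rw [List.map_map]
    refine (List.map_congr_left fun x hx => ?_).trans (List.map_id ms)
    simp [Nat.mod_eq_of_lt (Nat.lt_succ_of_le (h2 x hx))]
  have hfin := (Set.finite_univ (α := P.State)).prod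
    (P.finite_pushable.prod ((Set.finite_univ (α := P.State)).prod hms))
  have hex : ∀ a : P.State × List P.StackSym × P.State × List ℕ, ∃ C : ℕ,
      (∃ u v, P.Context L a.1 a.2.1 a.2.2.1 a.2.2.2 u v) → ∃ u v, u.length ≤ C ∧ v.length ≤ C ∧
        P.Context L a.1 a.2.1 a.2.2.1 a.2.2.2 u v := by
    intro a
    by_cases h : ∃ u v, P.Context L a.1 a.2.1 a.2.2.1 a.2.2.2 u v
    · obtain ⟨u, v, h⟩ := h
      exact ⟨max u.length v.length, fun _ => ⟨u, v, le_max_left _ _, le_max_right _ _, h⟩⟩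
    · exact ⟨0, fun h' => absurd h' h⟩
  choose f hf using hex
  obtain ⟨C, hC⟩ := (hfin.image f).bddAbove
  refine ⟨C, fun q ξ p ms hξ hlen hD hctx => ?_⟩
  obtain ⟨u, v, hu, hv, h⟩ := hf (q, ξ, p, ms) hctx
  have hle : f (q, ξ, p, ms) ≤ C := hC ⟨_, ⟨trivial, hξ, trivial,
    hlen.trans_le (hn ⟨ξ, hξ, rfl⟩), hD⟩, rfl⟩
  exact ⟨u, v, hu.trans hle, hv.trans hle, h⟩

/-- At a node the left child consumes the pushed word and the right child the remaining stack. The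
measures are part of the data, so exchanging a subtree changes neither the measures above it nor the
oscillation. The improved bound for a fold that does not grow absorbs the increment when both
children have equal Strahler number. -/
theorem Eval.factorTree {P : PDA T} {L : Language T} {C D : ℕ}
    (hC : ∀ q ξ p ms, ξ ∈ P.pushable → ms.length = ξ.length → (∀ x ∈ ms, x ≤ D) →
      (∃ u v, P.Context L q ξ p ms u v) →
      ∃ u v, u.length ≤ C ∧ v.length ≤ C ∧ P.Context L q ξ p ms u v)
    {q p : P.State} {ξ : List P.StackSym} {w : List T} {ms : List ℕ} (h : P.Eval q ξ w p ms) :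
    ξ ∈ P.pushable → (∀ x ∈ ms, x ≤ D) → (∃ u v, P.Context L q ξ p ms u v) →
    ∃ s, FactorTree (fun w => ∃ u v, u.length ≤ C ∧ v.length ≤ C ∧ u ++ w ++ v ∈ L) s w ∧
      ∀ a, s ≤ 2 * ms.foldl dyckCons a + 1 ∧
        (ms.foldl dyckCons a = a → s ≤ 2 * ms.foldl dyckCons a) := by
  induction h with
  | nil q =>
    intro hξ hD hctx
    obtain ⟨u, v, hu, hv, h⟩ := hC _ _ _ _ hξ rfl hD hctx
    exact ⟨0, .nil ⟨u, v, hu, hv, h _ (.nil q)⟩, fun a => ⟨by omega, by omega⟩⟩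
  | @cons q p₁ p₂ p b γ ξ' ξ w₁ w₂ ms' ms ha h₁ h₂ ih₁ ih₂ =>
    intro hξ hD hctx
    have e := Eval.cons ha h₁ h₂
    obtain ⟨u', v', hu', hv', h'⟩ := hC _ _ _ _ hξ e.length_eq hD hctx
    obtain ⟨u, v, hctx⟩ := hctx
    obtain ⟨s₁, t₁, b₁⟩ := ih₁ (.inr ⟨_, ha, List.suffix_rfl⟩)
      (fun x hx => (mem_le_foldl_dyckCons hx 0).trans (hD _ (by simp)))
      ⟨u ++ b.toList, w₂ ++ v, fun w hw => by simpa using hctx _ (.cons ha hw h₂)⟩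
    obtain ⟨s₂, t₂, b₂⟩ := ih₂
      (hξ.imp (List.suffix_cons _ _).trans fun ⟨α, hα, hs⟩ => ⟨α, hα, (List.suffix_cons _ _).trans hs⟩)
      (fun x hx => hD x (by simp [hx]))
      ⟨u ++ b.toList ++ w₁, v, fun w hw => by simpa using hctx _ (.cons ha h₁ hw)⟩
    refine ⟨_, .node ⟨u', v', hu', hv', h' _ e⟩ t₁ t₂, fun a => ?_⟩
    rw [List.foldl_cons]
    have hb₁ := (b₁ 0).1
    obtain ⟨hb₂, hb₂'⟩ := b₂ (dyckCons a (ms'.foldl dyckCons 0))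
    generalize ms'.foldl dyckCons 0 = c at *
    have h1 := le_foldl_dyckCons ms (dyckCons a c)
    generalize ms.foldl dyckCons (dyckCons a c) = d at *
    have h2 := le_dyckCons_right a c
    have h3 := le_dyckCons_left a c
    -- A fold that stays at `a` forces `a` odd and every entry below `a`, since `c = a` would lift
    -- the join to `a + 1`.
    have h4 : dyckCons a c = a → c < a := by
      unfold dyckCons dyckJoin; split_ifs <;> omega
    unfold strahler
    split_ifs <;> omega

/-- The words of a language of bounded oscillation are yields of trees of bounded Strahler number
in which the yields of all subtrees are factors, near both ends, of words of the language. -/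
theorem exists_factorTree (P : PDA T) (k : ℕ) :
    ∃ C : ℕ, ∀ w ∈ P.oscLanguage k, ∃ s ≤ 4 * k + 3, FactorTree
      (fun w => ∃ u v, u.length ≤ C ∧ v.length ≤ C ∧ u ++ w ++ v ∈ P.oscLanguage k) s w := by
  obtain ⟨C, hC⟩ := P.exists_context_bound (P.oscLanguage k) (2 * k + 1)
  refine ⟨C, fun w hw => ?_⟩
  obtain ⟨p, x, e, hk⟩ := mem_oscLanguage_iff.1 hw
  have hx := le_dyckCons_right 0 x
  -- Rank `k` bounds `dyckCons 0 x` by `2 * k + 1`, hence the Strahler number by `2 * (2 * k + 1) +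
  -- 1`.
  obtain ⟨s, hs, hb⟩ := e.factorTree hC (.inl List.suffix_rfl) (by simp; omega)
    ⟨[], [], fun w' hw' => by simpa using mem_oscLanguage_iff.2 ⟨p, x, hw', hk⟩⟩
  have := (hb 0).1
  simp only [List.foldl_cons, List.foldl_nil] at this
  exact ⟨s, by omega, hs⟩

end PDA

/-! ### The language `aⁿ bⁿ cⁿ` -/

theorem mem_langAnBnCn {w : List (Fin 3)} : w ∈ langAnBnCj ⊓ langAjBnCn ↔
    ∃ n : ℕ, w = .replicate n 0 ++ .replicate n 1 ++ .replicate n 2 := by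
  constructor
  · rintro ⟨⟨n, j, rfl⟩, m, i, h⟩
    have h1 := congrArg (List.count 1) h
    have h2 := congrArg (List.count 2) h
    simp [List.count_replicate] at h1 h2
    exact ⟨n, by rw [h2, h1]⟩
  · rintro ⟨n, rfl⟩
    exact ⟨⟨n, n, rfl⟩, n, n, rfl⟩

theorem getElem?_anbncn (n i : ℕ) :
    (List.replicate n (0 : Fin 3) ++ List.replicate n 1 ++ List.replicate n 2)[i]? =
      if i < n then some 0 else if i < 2 * n then some 1 else if i < 3 * n then some 2
        else none := by
  grind

/-- Only short contexts matter here, not the Strahler number. A subtree yield longer than `3 * C +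
3` starts with `a` and ends with `c`, because its contexts are too short to exhaust either block.
One of length at most `n` cannot reach across the block of `n` letters `b`. -/
theorem not_isBoundedOscillation_anbncn : ¬ IsBoundedOscillation (langAnBnCj ⊓ langAjBnCn) := by
  rintro ⟨k, P, hP⟩
  obtain ⟨C, hC⟩ := P.exists_factorTree k
  rw [← hP] at hC
  set n := 6 * C + 7 with hn
  obtain ⟨s, -, t⟩ := hC _ (mem_langAnBnCn.2 ⟨n, rfl⟩)
  obtain ⟨w, ⟨x, y, hw⟩, ⟨u, v, hu, hv, hL⟩, h1, h2⟩ := t.exists_infix (3 * C + 3) (by simp; omega)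
  obtain ⟨m, hm⟩ := mem_langAnBnCn.1 hL
  have hlen := congrArg List.length hm
  simp only [List.length_append, List.length_replicate] at hlen
  have w0 : w[0]? = some 0 := by
    have e := congrArg (·[u.length]?) hm
    simp only [getElem?_anbncn] at e
    rw [if_pos (by omega), List.append_assoc, List.getElem?_append_right le_rfl,
      List.getElem?_append_left (by omega), Nat.sub_self] at e
    exact e
  have w2 : w[w.length - 1]? = some 2 := by
    have e := congrArg (·[u.length + (w.length - 1)]?) hm
    simp only [getElem?_anbncn] at e
    rw [if_neg (by omega), if_neg (by omega), if_pos (by omega), List.append_assoc,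
      List.getElem?_append_right (by omega), List.getElem?_append_left (by omega),
      Nat.add_sub_cancel_left] at e
    exact e
  have e0 := congrArg (·[x.length]?) hw
  have e2 := congrArg (·[x.length + (w.length - 1)]?) hw
  simp only [getElem?_anbncn] at e0 e2
  rw [List.append_assoc, List.getElem?_append_right le_rfl, List.getElem?_append_left (by omega),
    Nat.sub_self, w0] at e0
  rw [List.append_assoc, List.getElem?_append_right (by omega),
    List.getElem?_append_left (by omega), Nat.add_sub_cancel_left, w2] at e2
  split_ifs at e0 e2 <;> first | omega | simp at e0 e2

/-! ### The Dyck language has unbounded oscillation -/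

/-- The height difference between the end and the start of a word. -/
def dyckHeight : List DyckStep → ℤ
  | [] => 0
  | .U :: w => dyckHeight w + 1
  | .D :: w => dyckHeight w - 1

theorem dyckHeight_append (u v : List DyckStep) :
    dyckHeight (u ++ v) = dyckHeight u + dyckHeight v := by
  induction u with
  | nil => simp [dyckHeight]
  | cons x u ih => cases x <;> simp only [List.cons_append, dyckHeight, ih] <;> omega

theorem dyckHeight_replicate_U (n : ℕ) : dyckHeight (.replicate n .U) = n := by
  induction n with
  | zero => rfl
  | succ n ih => rw [List.replicate_succ, dyckHeight, ih]; simp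

theorem dyckHeight_replicate_D (n : ℕ) : dyckHeight (.replicate n .D) = -n := by
  induction n with
  | zero => rfl
  | succ n ih => rw [List.replicate_succ, dyckHeight, ih]; push_cast; ring

theorem abs_dyckHeight_le (w : List DyckStep) : |dyckHeight w| ≤ w.length := by
  induction w with
  | nil => simp [dyckHeight]
  | cons x w ih =>
    rw [abs_le] at ih ⊢
    cases x <;> simp only [dyckHeight, List.length_cons] <;> push_cast <;> omega

theorem DyckPath.split (x : List DyckStep) : ∀ {n : ℕ} {y : List DyckStep}, DyckPath n (x ++ y) →
    ∃ m : ℕ, DyckPath m y ∧ (m : ℤ) = n + dyckHeight x := by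
  induction x with
  | nil => exact fun {n y} h => ⟨n, h, by simp [dyckHeight]⟩
  | cons a x ih =>
    intro n y h
    cases h with
    | up h =>
      obtain ⟨m, hm, e⟩ := ih h
      exact ⟨m, hm, by rw [e, dyckHeight]; push_cast; ring⟩
    | down h =>
      obtain ⟨m, hm, e⟩ := ih h
      exact ⟨m, hm, by rw [e, dyckHeight]; push_cast; ring⟩

theorem DyckPath.height_prefix {n : ℕ} {x y : List DyckStep} (h : DyckPath n (x ++ y)) :
    0 ≤ n + dyckHeight x := by
  obtain ⟨m, -, e⟩ := DyckPath.split x h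
  omega

theorem DyckPath.height_suffix {n : ℕ} {x y : List DyckStep} (h : DyckPath n (x ++ y)) :
    dyckHeight y ≤ 0 := by
  obtain ⟨m, hm, -⟩ := DyckPath.split x h
  rw [← List.append_nil y] at hm
  obtain ⟨l, hl, e⟩ := DyckPath.split y hm
  cases hl
  omega

/-- The word `w` raised by `c` levels. -/
def dyckRaise (c : ℕ) (w : List DyckStep) : List DyckStep :=
  .replicate c .U ++ w ++ .replicate c .D

/-- Words whose raised versions are Dyck words of growing rank, all of whose branchings are
separated by at least `c` levels. -/
def dyckCore (c : ℕ) : ℕ → List DyckStep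
  | 0 => []
  | n + 1 => dyckRaise c (dyckCore c n) ++ .replicate c .D ++
      (.replicate c .U ++ dyckRaise c (dyckCore c n))

theorem dyckPath_replicate_U_append {n : ℕ} {v : List DyckStep} (c : ℕ)
    (h : DyckPath (n + c) v) : DyckPath n (.replicate c .U ++ v) := by
  induction c generalizing n with
  | zero => exact h
  | succ c ih =>
    rw [List.replicate_succ]
    exact .up (ih (by rwa [Nat.add_right_comm]))

theorem dyckPath_replicate_D_append {n : ℕ} {v : List DyckStep} (c : ℕ)
    (h : DyckPath n v) : DyckPath (n + c) (.replicate c .D ++ v) := by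
  induction c with
  | zero => exact h
  | succ c ih =>
    rw [List.replicate_succ]
    exact .down ih

theorem dyckPath_raise_append (c m : ℕ) : ∀ {n : ℕ} {v : List DyckStep}, DyckPath n v →
    DyckPath n (dyckRaise c (dyckCore c m) ++ v) := by
  induction m with
  | zero =>
    intro n v h
    have := dyckPath_replicate_U_append c (dyckPath_replicate_D_append c h)
    simpa [dyckRaise, dyckCore] using this
  | succ m ih =>
    intro n v h
    have := dyckPath_replicate_U_append c (ih (dyckPath_replicate_D_append c
      (dyckPath_replicate_U_append c (ih (dyckPath_replicate_D_append c h)))))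
    rw [dyckRaise, dyckCore]
    simpa only [List.append_assoc] using this

theorem dyckPath_raise (c m : ℕ) : DyckPath 0 (dyckRaise c (dyckCore c m)) := by
  simpa using dyckPath_raise_append c m DyckPath.nil

/-- A factor `J` whose height drops and rises by less than `c` does not meet both copies of `H` in
`H dᶜ uᶜ H` without containing this word. -/
theorem infix_of_height_bounds {C c : ℕ} (hc : C < c) {l J r x y H : List DyckStep}
    (hH : DyckPath 0 H) (hpre : ∀ a b, J = a ++ b → -(C : ℤ) ≤ dyckHeight a)
    (hsuf : ∀ a b, J = a ++ b → dyckHeight b ≤ C)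
    (h : l ++ (J ++ r) = x ++ (H ++ .replicate c .D ++ (.replicate c .U ++ H)) ++ y) :
    H ++ .replicate c .D ++ (.replicate c .U ++ H) <:+: J ∨ H <:+: l ∨ H <:+: r := by
  have h1 : l ++ (J ++ r) =
      (x ++ H) ++ (.replicate c .D ++ (.replicate c .U ++ (H ++ y))) := by simp [h]
  obtain ⟨a, ha, hJ⟩ | ⟨a, rfl, -⟩ := List.append_eq_append_iff.1 h1
  swap
  · exact .inr (.inl ⟨x, a, rfl⟩)
  have h2 : J ++ r = (a ++ (.replicate c .D ++ .replicate c .U)) ++ (H ++ y) := by simp [hJ]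
  obtain ⟨e, -, rfl⟩ | ⟨e, rfl, he⟩ := List.append_eq_append_iff.1 h2
  · exact .inr (.inr ⟨e, y, by simp⟩)
  -- Now `J` contains the whole valley. If `J` began inside the left `H`, a suffix of `H` followed
  -- by the descent would fall below `-C`; symmetrically for the ascent and the right `H`.
  have hp := hpre (a ++ .replicate c .D) (.replicate c .U ++ e) (by simp)
  have hs := hsuf (a ++ .replicate c .D) (.replicate c .U ++ e) (by simp)
  rw [dyckHeight_append, dyckHeight_replicate_D] at hp
  rw [dyckHeight_append, dyckHeight_replicate_U] at hs
  obtain ⟨a', rfl, rfl⟩ | ⟨a', rfl, rfl⟩ := List.append_eq_append_iff.1 ha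
  · have := hH.height_suffix
    omega
  obtain ⟨e', rfl, rfl⟩ | ⟨e', rfl, rfl⟩ := List.append_eq_append_iff.1 he
  · exact .inl ⟨a', e', by simp⟩
  · have := hH.height_prefix
    omega

/-- The letter `b` can cost at most one letter of the slope `ūᶜ` in front of `w`, never a letter of
`w`. -/
theorem dyckCore_infix_of_raise_infix {c : ℕ} (hc : 0 < c) {b : Option DyckStep}
    {w v : List DyckStep} (h : dyckRaise c w <:+: b.toList ++ v) : w <:+: v := by
  obtain ⟨c, rfl⟩ : ∃ d, c = d + 1 := ⟨c - 1, by omega⟩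
  obtain ⟨x, y, h⟩ := h
  cases b with
  | none => exact ⟨x ++ .replicate (c + 1) .U, .replicate (c + 1) .D ++ y,
      by simpa [dyckRaise] using h⟩
  | some t =>
    obtain _ | ⟨t', x⟩ := x
    · simp only [dyckRaise, List.replicate_succ (a := DyckStep.U), List.cons_append,
        List.nil_append, Option.toList_some, List.cons.injEq] at h
      exact ⟨.replicate c .U, .replicate (c + 1) .D ++ y, by simpa using h.2⟩
    · simp only [List.cons_append, Option.toList_some, List.nil_append, List.cons.injEq] at h
      exact ⟨x ++ .replicate (c + 1) .U, .replicate (c + 1) .D ++ y,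
        by simpa [dyckRaise] using h.2⟩

theorem height_bounds_of_context {C : ℕ} {w : List DyckStep}
    (h : ∃ u v, u.length ≤ C ∧ v.length ≤ C ∧ u ++ w ++ v ∈ dyckLanguage) (x y : List DyckStep)
    (hw : w = x ++ y) : -(C : ℤ) ≤ dyckHeight x ∧ dyckHeight y ≤ C := by
  subst hw
  obtain ⟨u, v, hu, hv, h⟩ := h
  rw [mem_dyckLanguage_iff_dyckPath] at h
  have e : u ++ (x ++ y) ++ v = (u ++ x) ++ (y ++ v) := by simp
  rw [e] at h
  have h1 := h.height_prefix
  have h2 := h.height_suffix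
  rw [dyckHeight_append] at h1 h2
  have h3 := abs_le.1 (abs_dyckHeight_le u)
  have h4 := abs_le.1 (abs_dyckHeight_le v)
  push_cast at h1
  constructor <;> omega

/-- At every node some child has smaller Strahler number; take the other one as `J`. Either `J`
contains the entire core and induction applies to it, or a raised copy of the core of order one less
lies outside `J`, hence its core lies in the child of smaller Strahler number. -/
theorem FactorTree.not_dyckCore_infix {C s : ℕ} {w : List DyckStep}
    (h : FactorTree (fun w => ∃ u v, u.length ≤ C ∧ v.length ≤ C ∧ u ++ w ++ v ∈ dyckLanguage)
      s w) : ∀ n, s < n → ¬ dyckCore (C + 1) n <:+: w := by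
  induction h with
  | nil =>
    intro n hn h
    obtain ⟨n, rfl⟩ : ∃ m, n = m + 1 := ⟨n - 1, by omega⟩
    simpa [dyckCore, dyckRaise] using List.infix_nil.1 h
  | @node s t b u v _ hu hv ihu ihv =>
    intro n hn ⟨x, y, h⟩
    obtain ⟨n, rfl⟩ : ∃ m, n = m + 1 := ⟨n - 1, by omega⟩
    rw [dyckCore] at h
    have hlen : 2 ≤ (dyckRaise (C + 1) (dyckCore (C + 1) n)).length := by
      simp [dyckRaise]; omega
    have hst : (s < strahler s t ∧ t ≤ strahler s t) ∨ (t < strahler s t ∧ s ≤ strahler s t) := by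
      unfold strahler; split_ifs <;> omega
    obtain ⟨hs, ht⟩ | ⟨ht, hs⟩ := hst
    · obtain h | h | h := infix_of_height_bounds (l := b.toList ++ u) (J := v) (r := [])
        (x := x) (y := y)
        (Nat.lt_succ_self C) (dyckPath_raise (C + 1) n)
        (fun a b e => (height_bounds_of_context hv.holds a b e).1)
        (fun a b e => (height_bounds_of_context hv.holds a b e).2)
        (by rw [List.append_nil, List.append_assoc, h])
      · exact ihv (n + 1) (by omega) h
      · exact ihu n (by omega) (dyckCore_infix_of_raise_infix (by omega) h)
      · rw [List.infix_nil.1 h] at hlen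
        simp at hlen
    · obtain h | h | h := infix_of_height_bounds (l := b.toList) (J := u) (r := v)
        (x := x) (y := y)
        (Nat.lt_succ_self C) (dyckPath_raise (C + 1) n)
        (fun a b e => (height_bounds_of_context hu.holds a b e).1)
        (fun a b e => (height_bounds_of_context hu.holds a b e).2) h.symm
      · exact ihu (n + 1) (by omega) h
      · have h1 := h.length_le
        have h2 : b.toList.length ≤ 1 := by cases b <;> simp
        omega
      · exact ihv n (by omega) (dyckCore_infix_of_raise_infix (b := none) (by omega) h)

theorem not_isOscillating_dyckLanguage (k : ℕ) : ¬ IsOscillating k dyckLanguage := by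
  rintro ⟨P, hP⟩
  obtain ⟨C, hC⟩ := P.exists_factorTree k
  rw [← hP] at hC
  obtain ⟨s, hs, t⟩ := hC _ (mem_dyckLanguage_iff_dyckPath.2 (dyckPath_raise (C + 1) (4 * k + 4)))
  exact t.not_dyckCore_infix (4 * k + 4) (by omega) ⟨_, _, rfl⟩

/-! ### The main theorem -/

/-- Reading two letters takes two moves, so the first move pushes something and the footprint has
measure at least `2`. -/
theorem not_isOscillating_zero_top : ¬ IsOscillating 0 (⊤ : Language (Fin 3)) := by
  rintro ⟨P, hP⟩
  have h : [0, 0] ∈ P.oscLanguage 0 := hP ▸ Set.mem_univ _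
  obtain ⟨p, x, e, hx⟩ := PDA.mem_oscLanguage_iff.1 h
  obtain ⟨b, p₁, ξ, w₁, ms, -, h₁, hw, rfl⟩ := PDA.eval_singleton_iff.1 e
  have hb : b.toList.length ≤ 1 := by cases b <;> simp
  cases h₁ with
  | nil =>
    have := congrArg List.length hw
    simp only [List.length_cons, List.length_nil, List.length_append] at this
    omega
  | @cons _ _ _ _ _ _ _ _ _ _ ms' ms =>
    have h1 : 0 < (ms'.foldl dyckCons 0 :: ms).foldl dyckCons 0 :=
      (dyckCons_pos _ _).trans_le (le_foldl_dyckCons _ _)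
    generalize (ms'.foldl dyckCons 0 :: ms).foldl dyckCons 0 = y at *
    unfold dyckCons dyckJoin at hx
    split_ifs at hx
    all_goals omega

theorem isOscillating_bot {T : Type} (k : ℕ) : IsOscillating k (⊥ : Language T) := by
  refine ⟨⟨Unit, Unit, inferInstance, inferInstance, ∅, Set.finite_empty, (), ()⟩, ?_⟩
  ext w
  refine ⟨fun h => h.elim, fun h => ?_⟩
  obtain ⟨p, x, e, -⟩ := PDA.mem_oscLanguage_iff.1 h
  obtain ⟨b, p₁, ξ, w₁, ms, ha, -⟩ := PDA.eval_singleton_iff.1 e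
  exact ha.elim

theorem mainTheorem6 :
    -- union
    (∀ (T : Type) [Finite T] [Nonempty T] (L₁ L₂ : Language T),
      (∀ k : ℕ, IsOscillating k L₁ → IsOscillating k L₂ → IsOscillating k (L₁ ⊔ L₂)) ∧
      (IsBoundedOscillation L₁ → IsBoundedOscillation L₂ → IsBoundedOscillation (L₁ ⊔ L₂))) ∧
    -- intersection
    (∀ k : ℕ, 1 ≤ k →
      IsOscillating k langAnBnCj ∧ IsOscillating k langAjBnCn) ∧
    ¬ IsBoundedOscillation (langAnBnCj ⊓ langAjBnCn) ∧
    -- complement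
    (∀ k : ℕ, ∃ L : Language (Fin 3), IsOscillating k L ∧ ¬ IsOscillating k Lᶜ) ∧
    (∃ L : Language (Fin 3), IsBoundedOscillation L ∧ ¬ IsBoundedOscillation Lᶜ) ∧
    -- determinism
    (IsOscillating 1 evenPalindromes ∧ ¬ IsDCFL evenPalindromes) ∧
    (IsDCFL dyckLanguage ∧ ∀ k : ℕ, ¬ IsOscillating k dyckLanguage) ∧
    (¬ ∀ (T : Type) [Finite T] [Nonempty T] (L : Language T),
      IsDCFL L → IsBoundedOscillation L) ∧
    (∀ k : ℕ, 1 ≤ k → ¬ ∀ (T : Type) [Finite T] [Nonempty T] (L : Language T),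
      IsOscillating k L → IsDCFL L) := by
  have h₁ : ∀ k, 1 ≤ k → IsOscillating k langAnBnCj := fun k hk =>
    isOscillating_one_langAnBnCj.mono hk
  have h₂ : ∀ k, 1 ≤ k → IsOscillating k langAjBnCn := fun k hk =>
    isOscillating_one_langAjBnCn.mono hk
  have hcompl : (langAnBnCjᶜ ⊔ langAjBnCnᶜ)ᶜ = langAnBnCj ⊓ langAjBnCn := by
    rw [compl_sup, compl_compl, compl_compl]
  refine ⟨fun T _ _ L₁ L₂ => ⟨fun k => .sup, .sup⟩, fun k hk => ⟨h₁ k hk, h₂ k hk⟩,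
    not_isBoundedOscillation_anbncn, fun k => ?_, ?_,
    ⟨isOscillating_one_evenPalindromes, not_isDCFL_evenPalindromes⟩,
    ⟨isDCFL_dyckLanguage, not_isOscillating_dyckLanguage⟩, fun h => ?_, fun k hk h => ?_⟩
  · obtain rfl | hk := Nat.eq_zero_or_pos k
    · exact ⟨⊥, isOscillating_bot 0, by rw [compl_bot]; exact not_isOscillating_zero_top⟩
    -- If both complements are `k`-oscillating, so is their union, whose complement is the
    -- intersection. One of three languages is therefore a witness, without deciding which.
    by_cases c₁ : IsOscillating k langAnBnCjᶜ
    · by_cases c₂ : IsOscillating k langAjBnCnᶜ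
      · exact ⟨_, c₁.sup c₂, fun h => not_isBoundedOscillation_anbncn ⟨k, hcompl ▸ h⟩⟩
      · exact ⟨_, h₂ k hk, c₂⟩
    · exact ⟨_, h₁ k hk, c₁⟩
  · by_cases c₁ : IsBoundedOscillation langAnBnCjᶜ
    · by_cases c₂ : IsBoundedOscillation langAjBnCnᶜ
      · exact ⟨_, c₁.sup c₂, fun h => not_isBoundedOscillation_anbncn (hcompl ▸ h)⟩
      · exact ⟨_, ⟨1, h₂ 1 le_rfl⟩, c₂⟩
    · exact ⟨_, ⟨1, h₁ 1 le_rfl⟩, c₁⟩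
  · have : Finite DyckStep := Finite.of_injective (fun s : DyckStep => s = .U) (by
      intro a b hab; cases a <;> cases b <;> simp_all)
    have : Nonempty DyckStep := ⟨.U⟩
    obtain ⟨k, hk⟩ := h DyckStep dyckLanguage isDCFL_dyckLanguage
    exact not_isOscillating_dyckLanguage k hk
  · exact not_isDCFL_evenPalindromes
      (h Bool evenPalindromes (isOscillating_one_evenPalindromes.mono hk))
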